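/- Let $n\ge 1$ be an integer, $\sigma\ge 1$ and $m\in[1,2)$ real, and consider the Cauchy problem $$u_{tt}+(-\Delta)^{\sigma}u+u-g*u=|u|^p,\qquad u(0,x)=0,\quad u_t(0,x)=u_1(x),\qquad x\in\mathbb R^n,\ t>0,$$ where $g(t)=e^{-t}$, $(g*u)(t,x)=\int_0^t g(t-\tau)u(\tau,x)\,d\tau$, and $(-\Delta)^\sigma$ is the Fourier multiplier with symbol $|\xi|^{2\sigma}$. Let $u_1\in L^m(\mathbb R^n)$ be real-valued and assume $$\int_{\mathbb R^n}u_1(x)\,dx>0\quad\text{if } m=1,$$ or, if $m\in(1,2)$, that there are constants $c>0$ and $R_0$ such that $$u_1(x)\ \ge\ c\,|x|^{-n/m}\bigl(\log(1+|x|)\bigr)^{-1}\quad\text{for almost every } x \text{ with } |x|\ge R_0 .$$ For $0<T\le\infty$, a Sobolev solution on $[0,T)$ is a real-valued $u\in C([0,T),L^2(\mathbb R^n))$ with $u(0)=0$ and $|u|^p\in L^1_{\mathrm{loc}}([0,T)\times\mathbb R^n)$ such that, for all $\eta\in C_c^\infty([0,T))$ and $\varphi\in C_c^\infty(\mathbb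 R^n)$, $$\int_0^T\!\!\int_{\mathbb R^n}\Bigl(u\,\eta''\varphi+u\,\eta\,(-\Delta)^\sigma\varphi+u\,\eta\varphi-(g*u)\,\eta\varphi\Bigr)dx\,dt=\eta(0)\int_{\mathbb R^n}u_1\varphi\,dx+\int_0^T\!\!\int_{\mathbb R^n}|u|^p\,\eta\varphi\,dx\,dt .$$ If $$1<p<1+\frac{2m\sigma}{n},$$ then every Sobolev solution blows up in finite time, in the sense that every Sobolev solution on an interval $[0,T)$ with $0<T\le\infty$ has $T<\infty$; that is, there is no global (in time) Sobolev solution $u\in C([0,\infty),L^2(\mathbb R^n))$. -/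

import Mathlib

open MeasureTheory Set
open scoped FourierTransform ContDiff

noncomputable section

/-- The fractional Laplacian `(-Δ)^σ` of a real function on `ℝⁿ`, as the Fourier multiplier with
symbol `|ξ|^{2σ}`. Mathlib's Fourier transform is taken with the phase `exp (-2πi⟨x, ξ⟩)`, hence the
factor `2π`. It is applied only to smooth compactly supported functions, for which the
inverse Fourier integral converges absolutely and is real. -/
def fracLaplacian {n : ℕ} (σ : ℝ) (φ : EuclideanSpace ℝ (Fin n) → ℝ)
    (x : EuclideanSpace ℝ (Fin n)) : ℝ :=
  (𝓕⁻ (fun ξ : EuclideanSpace ℝ (Fin n) =>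
    (((2 * Real.pi * ‖ξ‖) ^ (2 * σ) : ℝ) : ℂ) *
      𝓕 (fun y : EuclideanSpace ℝ (Fin n) => (φ y : ℂ)) ξ) x).re

/-- The memory term `(g ∗ u)(t) = ∫₀ᵗ e^{-(t-τ)} u(τ) dτ`, an `L²`-valued integral. -/
def memoryTerm {n : ℕ} (u : ℝ → Lp ℝ 2 (volume : Measure (EuclideanSpace ℝ (Fin n)))) (t : ℝ) :
    Lp ℝ 2 (volume : Measure (EuclideanSpace ℝ (Fin n))) :=
  ∫ τ in (0 : ℝ)..t, Real.exp (-(t - τ)) • u τ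

/-- `u ∈ C([0,T), L²(ℝⁿ))`, with `0 < T ≤ ∞`, is a Sobolev solution on `[0,T)` of
`u_tt + (-Δ)^σ u + u - g ∗ u = |u|^p`, `u(0) = 0`, `u_t(0) = u₁`, in the sense of
distributions. The datum `u(0) = 0` is attained in `L²`; the datum `u₁` enters through
the boundary term `η(0) ∫ u₁ φ` of the weak formulation. The values of `u` outside
`[0,T)` play no role. -/
structure IsSobolevSolution {n : ℕ} (σ p : ℝ) (u₁ : EuclideanSpace ℝ (Fin n) → ℝ) (T : EReal)
    (u : ℝ → Lp ℝ 2 (volume : Measure (EuclideanSpace ℝ (Fin n)))) : Prop where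
  lifespan_pos : 0 < T
  continuousOn : ContinuousOn u {t : ℝ | 0 ≤ t ∧ (t : EReal) < T}
  initial : u 0 = 0
  /-- `|u|^p` is locally integrable on `[0,T) × ℝⁿ`. -/
  power_locallyIntegrable : ∀ t : ℝ, (t : EReal) < T → ∀ r : ℝ,
    ∫⁻ s in Ioc 0 t, ∫⁻ x in Metric.ball (0 : EuclideanSpace ℝ (Fin n)) r, ‖u s x‖ₑ ^ p < ⊤
  /-- The equation tested with `η(t) φ(x)`, where `η ∈ C_c^∞([0,T))`, `φ ∈ C_c^∞(ℝⁿ)`. -/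
  weak_equation : ∀ (η : ℝ → ℝ) (φ : EuclideanSpace ℝ (Fin n) → ℝ),
    ContDiff ℝ ∞ η → HasCompactSupport η → tsupport η ⊆ {t : ℝ | (t : EReal) < T} →
    ContDiff ℝ ∞ φ → HasCompactSupport φ →
    (∫ t in Ioi (0 : ℝ),
      (iteratedDeriv 2 η t * ∫ x, u t x * φ x)
        + (η t * ∫ x, u t x * fracLaplacian σ φ x)
        + (η t * ∫ x, u t x * φ x)
        - (η t * ∫ x, memoryTerm u t x * φ x))
      = η 0 * (∫ x, u₁ x * φ x)
        + ∫ t in Ioi (0 : ℝ), η t * ∫ x, |u t x| ^ p * φ x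

end

/-! The proof is a test function argument with two adaptations: one for the memory term, one for the
nonlocal operator.

Memory. Put `U = ∫ u φ` and `V = g ∗ U`, so that `V' = U - V` and `V 0 = 0`. Integrating `(κ V)'`
gives `∫ (κ - κ')(U - V) = -∫ κ' U`. Testing in time with `η = κ - κ'` thus turns mass plus memory
into first-order damping (`integral_sub_deriv_mul_memory`), and the natural scaling becomes time `R
^ (2σ)` against space `R`. If `κ 0 = 1`, `κ' 0 = 0` and `κ' ≤ 0` for positive times, then `η 0 = 1`
and `η ≥ κ`, so the nonlinear term keeps its sign.

Nonlocality. `(-Δ)^σ φ` is in general not supported in the support of `φ`, but it decays like `(1 +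
‖x‖) ^ (-(n + 2σ))` (`exists_abs_fracLaplacian_le`). It is therefore dominated by a sum of lattice
translates of `φ` with summable weights (`exists_enorm_fracLaplacian_le_tsum`). Testing with all
`ψ_y(x) = φ (x / R - y)` at once and taking suprema over `y` closes the estimate. With `M = sup_y ∫∫
κ |u|^p ψ_y`, Hölder's inequality gives `∫ u₁ ψ_y + ∫∫ κ |u|^p ψ_y ≤ D R^α M^(1/p)`, where `α = -2σ
+ (n + 2σ)(1 - 1/p)`; this is the content of `exists_scaled_estimate`. A lower bound `-B` for `∫ u₁
ψ_y`, uniform in `y`, then bounds `M`.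

Conclusion. For `m = 1` one has `α < 0`, so `M` stays bounded and `R → ∞` yields `∫ u₁ ≤ 0`. For `m
> 1`, eliminating `M` gives `∫ u₁ ψ_0 ≤ B + C R^(α p / (p - 1))`, whereas the data force growth like
`R^(n - n/m) / log R`. Since `α p / (p - 1) = n - 2σ / (p - 1)`, the two are incompatible exactly
when `p < 1 + 2mσ/n`. -/

/-! ### Spatial decay of the fractional Laplacian of a test function, via the heat semigroup -/

/-- Near zero the first factor is at most `r ^ N`, and `N > σ` makes the product integrable; at
infinity it is at most one, and `σ > 0` suffices. -/
lemma integrableOn_one_sub_exp_neg_pow {σ : ℝ} {N : ℕ} (hσ : 0 < σ) (hN : σ < N) :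
    IntegrableOn (fun r : ℝ => (1 - Real.exp (-r)) ^ N * r ^ (-1 - σ)) (Ioi 0) := by
  have hmeas : Measurable fun r : ℝ => (1 - Real.exp (-r)) ^ N * r ^ (-1 - σ) := by fun_prop
  have h0 : ∀ r : ℝ, 0 < r → 0 ≤ 1 - Real.exp (-r) ∧ 1 - Real.exp (-r) ≤ 1 ∧
      1 - Real.exp (-r) ≤ r := fun r hr =>
    ⟨by have := Real.exp_le_one_iff.2 (neg_nonpos.2 hr.le); linarith,
     by have := Real.exp_pos (-r); linarith,
     by have := Real.add_one_le_exp (-r); linarith⟩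
  rw [← Ioc_union_Ioi_eq_Ioi zero_le_one]
  refine IntegrableOn.union ?_ ?_
  · have h1 : IntegrableOn (fun r : ℝ => r ^ ((N : ℝ) - 1 - σ)) (Ioc 0 1) := by
      rw [← intervalIntegrable_iff_integrableOn_Ioc_of_le zero_le_one]
      exact intervalIntegral.intervalIntegrable_rpow' (by linarith)
    refine Integrable.mono' h1 hmeas.aestronglyMeasurable ?_
    filter_upwards [ae_restrict_mem measurableSet_Ioc] with r hr
    obtain ⟨ha, hb, hc⟩ := h0 r hr.1
    rw [Real.norm_of_nonneg (mul_nonneg (pow_nonneg ha _) (Real.rpow_nonneg hr.1.le _)),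
      show (N : ℝ) - 1 - σ = N + (-1 - σ) by ring, Real.rpow_add hr.1, Real.rpow_natCast]
    gcongr
    exact Real.rpow_nonneg hr.1.le _
  · have h1 : IntegrableOn (fun r : ℝ => r ^ (-1 - σ)) (Ioi 1) :=
      integrableOn_Ioi_rpow_of_lt (by linarith) zero_lt_one
    refine Integrable.mono' h1 hmeas.aestronglyMeasurable ?_
    filter_upwards [ae_restrict_mem measurableSet_Ioi] with r hr
    have hr' : 0 < r := zero_lt_one.trans hr
    obtain ⟨ha, hb, hc⟩ := h0 r hr'
    rw [Real.norm_of_nonneg (mul_nonneg (pow_nonneg ha _) (Real.rpow_nonneg hr'.le _))]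
    exact mul_le_of_le_one_left (Real.rpow_nonneg hr'.le _) (pow_le_one₀ ha hb)

lemma one_sub_exp_neg_mul_pow_eq {σ : ℝ} {N : ℕ} {l : ℝ} (hl : 0 < l) {r : ℝ} (hr : 0 < r) :
    (1 - Real.exp (-(r * l))) ^ N * r ^ (-1 - σ) =
      l ^ (1 + σ) * ((1 - Real.exp (-(r * l))) ^ N * (r * l) ^ (-1 - σ)) := by
  rw [Real.mul_rpow hr.le hl.le, show (-1 - σ) = -(1 + σ) by ring, Real.rpow_neg hl.le]
  have : l ^ (1 + σ) ≠ 0 := (Real.rpow_pos_of_pos hl _).ne'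
  field_simp

lemma integrableOn_one_sub_exp_neg_mul_pow {σ : ℝ} {N : ℕ} (hσ : 0 < σ) (hN : σ < N) {l : ℝ}
    (hl : 0 ≤ l) :
    IntegrableOn (fun r : ℝ => (1 - Real.exp (-(r * l))) ^ N * r ^ (-1 - σ)) (Ioi 0) := by
  have hN0 : N ≠ 0 := by rintro rfl; simp at hN; linarith
  rcases hl.eq_or_lt with rfl | hl
  · simp [hN0]
  have h := (integrableOn_Ioi_comp_mul_right_iff
    (fun r : ℝ => (1 - Real.exp (-r)) ^ N * r ^ (-1 - σ)) 0 hl).2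
    (by simpa using integrableOn_one_sub_exp_neg_pow hσ hN)
  refine IntegrableOn.congr_fun (h.const_mul (l ^ (1 + σ))) (fun r hr => ?_) measurableSet_Ioi
  exact (one_sub_exp_neg_mul_pow_eq hl hr).symm

/-- The integral representation of `l ^ σ` by powers of `1 - exp (-r l)`. -/
lemma exists_integral_one_sub_exp_neg_mul_pow {σ : ℝ} {N : ℕ} (hσ : 0 < σ) (hN : σ < N) :
    ∃ c > (0 : ℝ), ∀ l : ℝ, 0 ≤ l →
      ∫ r in Ioi (0 : ℝ), (1 - Real.exp (-(r * l))) ^ N * r ^ (-1 - σ) = c * l ^ σ := by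
  have hN0 : N ≠ 0 := by rintro rfl; simp at hN; linarith
  refine ⟨∫ r in Ioi (0 : ℝ), (1 - Real.exp (-r)) ^ N * r ^ (-1 - σ), ?_, fun l hl => ?_⟩
  · refine (setIntegral_pos_iff_support_of_nonneg_ae ?_
      (integrableOn_one_sub_exp_neg_pow hσ hN)).2 ?_
    · filter_upwards [ae_restrict_mem measurableSet_Ioi] with r hr
      have := Real.exp_le_one_iff.2 (neg_nonpos.2 (le_of_lt (mem_Ioi.1 hr)))
      exact mul_nonneg (pow_nonneg (by linarith) _) (Real.rpow_nonneg (le_of_lt hr) _)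
    · have : Function.support (fun r : ℝ => (1 - Real.exp (-r)) ^ N * r ^ (-1 - σ)) ∩ Ioi 0
          = Ioi 0 := by
        refine inter_eq_right.2 fun r hr => ?_
        have h1 : Real.exp (-r) < 1 := by simpa using hr
        exact mul_ne_zero (pow_ne_zero _ (by linarith)) (Real.rpow_pos_of_pos hr _).ne'
      rw [this]; simp
  · rcases hl.eq_or_lt with rfl | hl
    · simp [hN0, Real.zero_rpow hσ.ne']
    rw [setIntegral_congr_fun measurableSet_Ioi
      (fun r hr => one_sub_exp_neg_mul_pow_eq (σ := σ) (N := N) hl hr), integral_const_mul,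
      integral_comp_mul_right_Ioi (fun r : ℝ => (1 - Real.exp (-r)) ^ N * r ^ (-1 - σ)) 0 hl]
    rw [Real.rpow_add hl, Real.rpow_one, zero_mul, smul_eq_mul]
    field_simp

/-- Applying the heat semigroup on the Fourier side is convolution with the Gauss kernel. -/
lemma integral_fourier_mul_gaussian {n : ℕ} {f : EuclideanSpace ℝ (Fin n) → ℂ}
    (hf : Integrable f) {s : ℝ} (hs : 0 < s) (x : EuclideanSpace ℝ (Fin n)) :
    ∫ ξ, 𝓕 f ξ * Complex.exp (-(s * (2 * Real.pi * ‖ξ‖) ^ 2 : ℝ)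
        + 2 * Real.pi * Complex.I * (inner ℝ x ξ : ℝ)) =
      ∫ y, f y * (((4 * Real.pi * s) ^ (-((n : ℝ) / 2)) *
        Real.exp (-(‖x - y‖ ^ 2 / (4 * s))) : ℝ) : ℂ) := by
  set b : ℝ := s * (2 * Real.pi) ^ 2 with hb
  have hb0 : 0 < b := by positivity
  set g : EuclideanSpace ℝ (Fin n) → ℂ := fun ξ => Complex.exp (-(b : ℂ) * ‖ξ‖ ^ 2
    + 2 * Real.pi * Complex.I * (inner ℝ x ξ : ℝ)) with hg
  have hgi : Integrable g := by
    have := GaussianFourier.integrable_cexp_neg_mul_sq_norm_add (b := (b : ℂ)) (by simpa using hb0)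
      (2 * Real.pi * Complex.I) x
    exact this
  have hflip := VectorFourier.integral_fourierIntegral_smul_eq_flip (L := innerₗ _)
    Real.continuous_fourierChar continuous_inner hf hgi
  simp only [flip_innerₗ] at hflip
  have e1 : ∀ ξ, 𝓕 f ξ * Complex.exp (-(s * (2 * Real.pi * ‖ξ‖) ^ 2 : ℝ)
        + 2 * Real.pi * Complex.I * (inner ℝ x ξ : ℝ)) = 𝓕 f ξ • g ξ := by
    intro ξ
    simp only [hg, hb, smul_eq_mul]
    congr 2
    push_cast; ring
  have e2 : ∀ y, f y * (((4 * Real.pi * s) ^ (-((n : ℝ) / 2)) *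
        Real.exp (-(‖x - y‖ ^ 2 / (4 * s))) : ℝ) : ℂ) = f y • 𝓕 g y := by
    intro y
    have := fourier_gaussian_innerProductSpace' (V := EuclideanSpace ℝ (Fin n)) (b := (b : ℂ))
      (by simpa using hb0) x y
    rw [hg, this]
    have h1 : ((Real.pi : ℂ) / b) ^ ((Module.finrank ℝ (EuclideanSpace ℝ (Fin n)) : ℂ) / 2) =
        (((4 * Real.pi * s) ^ (-((n : ℝ) / 2)) : ℝ) : ℂ) := by
      rw [finrank_euclideanSpace_fin, Real.rpow_neg (by positivity), ← Real.inv_rpow (by positivity),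
        Complex.ofReal_cpow (by positivity)]
      have : (4 * Real.pi * s)⁻¹ = Real.pi / b := by
        rw [hb]; have := Real.pi_pos; field_simp; ring
      rw [this]; push_cast; rfl
    have h2 : (-(Real.pi : ℂ) ^ 2 * ‖x - y‖ ^ 2 / b) = ((-(‖x - y‖ ^ 2 / (4 * s)) : ℝ) : ℂ) := by
      have : -(‖x - y‖ ^ 2 / (4 * s)) = -Real.pi ^ 2 * ‖x - y‖ ^ 2 / b := by
        rw [hb]; have := Real.pi_pos; field_simp; ring
      rw [this]; push_cast; rfl
    rw [h1, h2, smul_eq_mul]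
    push_cast; rfl
  simp_rw [e1, e2]
  exact hflip

lemma integrable_rpow_norm_mul_fourier {n : ℕ} {f : EuclideanSpace ℝ (Fin n) → ℂ}
    (hf : ContDiff ℝ ∞ f) (hf' : HasCompactSupport f) {a : ℝ} (ha : 0 ≤ a) :
    Integrable fun ξ => (2 * Real.pi * ‖ξ‖) ^ a * ‖𝓕 f ξ‖ := by
  set g := 𝓕 (hf'.toSchwartzMap hf) with hg
  have hgf : ∀ ξ, g ξ = 𝓕 f ξ := fun ξ => by
    rw [hg, SchwartzMap.fourier_coe]; rfl
  obtain ⟨k, hk⟩ := exists_nat_ge a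
  have h0 := g.integrable_pow_mul (μ := volume) 0
  have hk' := g.integrable_pow_mul (μ := volume) k
  have hmeas : Continuous fun ξ => (2 * Real.pi * ‖ξ‖) ^ a * ‖g ξ‖ :=
    ((continuous_const.mul continuous_norm).rpow_const fun _ => Or.inr ha).mul g.continuous.norm
  have : Integrable fun ξ => (2 * Real.pi * ‖ξ‖) ^ a * ‖g ξ‖ := by
    refine Integrable.mono' ((h0.add (hk'.const_mul ((2 * Real.pi) ^ k))))
      hmeas.aestronglyMeasurable (Filter.Eventually.of_forall fun ξ => ?_)
    have hx : 0 ≤ 2 * Real.pi * ‖ξ‖ := by positivity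
    rw [Real.norm_of_nonneg (by positivity)]
    have : (2 * Real.pi * ‖ξ‖) ^ a ≤ 1 + (2 * Real.pi) ^ k * ‖ξ‖ ^ k := by
      rcases le_total (2 * Real.pi * ‖ξ‖) 1 with h | h
      · exact (Real.rpow_le_one hx h ha).trans (le_add_of_nonneg_right (by positivity))
      · rw [← mul_pow, ← Real.rpow_natCast]
        exact (Real.rpow_le_rpow_of_exponent_le h hk).trans (le_add_of_nonneg_left zero_le_one)
    calc _ ≤ (1 + (2 * Real.pi) ^ k * ‖ξ‖ ^ k) * ‖g ξ‖ := by gcongr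
      _ = _ := by simp only [Pi.add_apply, pow_zero]; ring
  simpa only [hgf] using this

lemma integrableOn_rpow_mul_exp_neg_div {a b : ℝ} (ha : 0 < a) (hb : 0 < b) :
    IntegrableOn (fun r : ℝ => r ^ (-1 - a) * Real.exp (-(b / r))) (Ioi 0) := by
  have h := (integrableOn_Ioi_comp_rpow_iff (fun s : ℝ => s ^ (a - 1) * Real.exp (-b * s))
    (p := -1) (by norm_num)).2 (by
      simpa using integrableOn_rpow_mul_exp_neg_mul_rpow (p := 1) (s := a - 1) (by linarith) one_pos hb)
  refine h.congr_fun (fun r hr => ?_) measurableSet_Ioi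
  have hr : 0 < r := hr
  simp only [abs_neg, abs_one, one_mul, smul_eq_mul, Real.rpow_neg_one, ← mul_assoc]
  rw [Real.inv_rpow hr.le, ← Real.rpow_neg hr.le, ← Real.rpow_add hr]
  congr 2
  · ring
  · ring

/-- The substitution `r = d ^ 2 * s` extracts the power of `d`, so `C` is the integral at `d = 1`.
This turns Gaussian bounds in `d` into polynomial decay. -/
lemma exists_integral_rpow_mul_exp_neg_div {a b : ℝ} (ha : 0 < a) (hb : 0 < b) :
    ∃ C ≥ (0 : ℝ), ∀ d : ℝ, 0 < d →
      IntegrableOn (fun r : ℝ => r ^ (-1 - a) * Real.exp (-(b * d ^ 2 / r))) (Ioi 0) ∧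
      ∫ r in Ioi (0 : ℝ), r ^ (-1 - a) * Real.exp (-(b * d ^ 2 / r)) = C * d ^ (-(2 * a)) := by
  refine ⟨∫ r in Ioi (0 : ℝ), r ^ (-1 - a) * Real.exp (-(b / r)), ?_, fun d hd =>
    ⟨integrableOn_rpow_mul_exp_neg_div ha (by positivity), ?_⟩⟩
  · exact setIntegral_nonneg measurableSet_Ioi fun r hr =>
      mul_nonneg (Real.rpow_nonneg (le_of_lt hr) _) (Real.exp_pos _).le
  have hl : 0 < (d ^ 2)⁻¹ := by positivity
  have := integral_comp_mul_right_Ioi (fun r : ℝ => r ^ (-1 - a) * Real.exp (-(b / r))) 0 hl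
  rw [zero_mul, inv_inv, smul_eq_mul] at this
  have h2 : (d ^ 2) ^ (-1 - a) * d ^ 2 = d ^ (-(2 * a)) := by
    rw [← Real.rpow_natCast d 2, ← Real.rpow_mul hd.le, ← Real.rpow_add hd]
    congr 1; push_cast; ring
  rw [← h2, mul_comm (∫ r in Ioi (0 : ℝ), r ^ (-1 - a) * Real.exp (-(b / r))), mul_assoc,
    ← this, ← integral_const_mul]
  refine setIntegral_congr_fun measurableSet_Ioi fun r hr => ?_
  have hr : 0 < r := hr
  rw [Real.mul_rpow hr.le hl.le, Real.inv_rpow (by positivity)]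
  have : (d ^ 2) ^ (-1 - a) ≠ 0 := (Real.rpow_pos_of_pos (by positivity) _).ne'
  have e : b / (r * (d ^ 2)⁻¹) = b * d ^ 2 / r := by field_simp
  rw [e]; field_simp

/-- The inverse Fourier integral of the difference `(1 - e^{sΔ})^N f`, at distance `d` from the
support of `f`. -/
lemma norm_integral_one_sub_exp_pow_mul_fourier_le {n : ℕ} {f : EuclideanSpace ℝ (Fin n) → ℂ}
    (hf : ContDiff ℝ ∞ f) (hf' : HasCompactSupport f) {N : ℕ} {d : ℝ}
    (hd : 0 < d) {x : EuclideanSpace ℝ (Fin n)} (hx : ∀ y, f y ≠ 0 → d ≤ ‖x - y‖) {r : ℝ}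
    (hr : 0 < r) :
    ‖∫ ξ, Complex.exp (2 * Real.pi * Complex.I * (inner ℝ x ξ : ℝ)) * (𝓕 f ξ *
        (((1 - Real.exp (-(r * (2 * Real.pi * ‖ξ‖) ^ 2))) ^ N : ℝ) : ℂ))‖ ≤
      2 ^ N * (∫ y, ‖f y‖) * (r ^ (-((n : ℝ) / 2)) * Real.exp (-(1 / (4 * (N + 1)) * d ^ 2 / r))) := by
  have hfi : Integrable f := hf.continuous.integrable_of_hasCompactSupport hf'
  have hFi : Integrable (𝓕 f) := by
    have := (𝓕 (hf'.toSchwartzMap hf)).integrable (μ := volume)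
    rw [SchwartzMap.fourier_coe] at this
    exact this
  have hFc : AEStronglyMeasurable (𝓕 f) volume := hFi.1
  set T : ℕ → EuclideanSpace ℝ (Fin n) → ℂ := fun k ξ => 𝓕 f ξ *
    Complex.exp (-((k * r) * (2 * Real.pi * ‖ξ‖) ^ 2 : ℝ)
        + 2 * Real.pi * Complex.I * (inner ℝ x ξ : ℝ)) with hT
  have hTi : ∀ k, Integrable (T k) := by
    intro k
    refine hFi.mul_bdd (c := 1) (by fun_prop) (Filter.Eventually.of_forall fun ξ => ?_)
    rw [Complex.norm_exp]
    simp only [Complex.add_re, Complex.neg_re, Complex.ofReal_re, Complex.mul_re, Complex.I_re,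
      Complex.I_im, Complex.ofReal_im]
    simp
    positivity
  have hexp : ∀ ξ, Complex.exp (2 * Real.pi * Complex.I * (inner ℝ x ξ : ℝ)) * (𝓕 f ξ *
        (((1 - Real.exp (-(r * (2 * Real.pi * ‖ξ‖) ^ 2))) ^ N : ℝ) : ℂ)) =
      ∑ k ∈ Finset.range (N + 1), ((-1) ^ k * (N.choose k) : ℂ) * T k ξ := by
    intro ξ
    have : (1 - Real.exp (-(r * (2 * Real.pi * ‖ξ‖) ^ 2))) ^ N =
        ∑ k ∈ Finset.range (N + 1), (-1) ^ k * (N.choose k : ℝ) *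
          Real.exp (-((k * r) * (2 * Real.pi * ‖ξ‖) ^ 2)) := by
      rw [sub_eq_neg_add, add_pow]
      refine Finset.sum_congr rfl fun k _ => ?_
      rw [neg_pow, ← Real.exp_nat_mul, one_pow, mul_one,
        show (k : ℝ) * -(r * (2 * Real.pi * ‖ξ‖) ^ 2) = -((k * r) * (2 * Real.pi * ‖ξ‖) ^ 2) by ring]
      ring
    rw [this, Complex.ofReal_sum, Finset.mul_sum, Finset.mul_sum]
    refine Finset.sum_congr rfl fun k _ => ?_
    simp only [hT]
    rw [Complex.exp_add]
    push_cast
    ring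
  simp_rw [hexp]
  rw [integral_finsetSum _ fun k _ => (hTi k).const_mul _]
  have hbound : ∀ k ∈ Finset.range (N + 1), ‖∫ ξ, ((-1) ^ k * (N.choose k) : ℂ) * T k ξ‖ ≤
      (N.choose k : ℝ) * ((∫ y, ‖f y‖) * (r ^ (-((n : ℝ) / 2)) *
        Real.exp (-(1 / (4 * (N + 1)) * d ^ 2 / r)))) := by
    intro k hk
    rw [integral_const_mul, norm_mul, norm_mul, norm_pow, norm_neg, norm_one, one_pow, one_mul,
      Complex.norm_natCast]
    refine mul_le_mul_of_nonneg_left ?_ (by positivity)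
    rcases Nat.eq_zero_or_pos k with rfl | hk0
    -- The `k = 0` term carries no heat flow: by Fourier inversion it is `f x`, which vanishes
    -- because `x` is at positive distance from the points where `f` is nonzero.
    · have h0 : ∫ ξ, T 0 ξ = f x := by
        have hinv := hf.continuous.fourierInv_fourier_eq hfi hFi
        rw [← congr_fun hinv x, Real.fourierInv_eq']
        refine integral_congr_ae (Filter.Eventually.of_forall fun ξ => ?_)
        simp only [hT, smul_eq_mul]
        rw [mul_comm, real_inner_comm]
        congr 2
        push_cast
        ring
      have hfx : f x = 0 := by
        by_contra h
        have := hx x h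
        simp at this
        linarith
      rw [h0, hfx, norm_zero]
      positivity
    -- For `1 ≤ k ≤ N + 1` the heat kernel at time `k * r` has prefactor at most `r ^ (-n/2)`, and
    -- its Gaussian is at most the one with `N + 1` in place of `k`.
    · have hk1 : (1 : ℝ) ≤ k := by exact_mod_cast hk0
      have hkN : (k : ℝ) ≤ N + 1 := by exact_mod_cast (Finset.mem_range.1 hk).le
      rw [hT, integral_fourier_mul_gaussian hfi (by positivity) x]
      refine (norm_integral_le_integral_norm _).trans ?_
      rw [← integral_mul_const]
      refine integral_mono_of_nonneg (Filter.Eventually.of_forall fun y => norm_nonneg _)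
        (hfi.norm.mul_const _) (Filter.Eventually.of_forall fun y => ?_)
      simp only [norm_mul]
      by_cases hy : f y = 0
      · simp [hy]
      have hdy := hx y hy
      refine mul_le_mul_of_nonneg_left ?_ (norm_nonneg _)
      rw [Complex.norm_real, Real.norm_of_nonneg (by positivity)]
      have hpi := Real.pi_gt_three
      refine mul_le_mul ?_ ?_ (Real.exp_pos _).le (by positivity)
      · refine Real.rpow_le_rpow_of_nonpos hr ?_ (by have : (0:ℝ) ≤ n := by positivity
                                                     linarith)
        nlinarith [mul_le_mul_of_nonneg_right hk1 hr.le]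
      · rw [Real.exp_le_exp, neg_le_neg_iff]
        calc 1 / (4 * ((N : ℝ) + 1)) * d ^ 2 / r = d ^ 2 / (4 * ((N + 1) * r)) := by field_simp
          _ ≤ ‖x - y‖ ^ 2 / (4 * (k * r)) := by gcongr
  refine (norm_sum_le _ _).trans ((Finset.sum_le_sum hbound).trans (le_of_eq ?_))
  rw [← Finset.sum_mul]
  have : ∑ k ∈ Finset.range (N + 1), (N.choose k : ℝ) = 2 ^ N := by
    exact_mod_cast Nat.sum_range_choose N
  rw [this]; ring

lemma fracLaplacian_eq_re_integral {n : ℕ} (σ : ℝ) (φ : EuclideanSpace ℝ (Fin n) → ℝ)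
    (x : EuclideanSpace ℝ (Fin n)) :
    fracLaplacian σ φ x = (∫ ξ, Complex.exp (2 * Real.pi * Complex.I * (inner ℝ x ξ : ℝ)) *
      (𝓕 (fun y => (φ y : ℂ)) ξ * (((2 * Real.pi * ‖ξ‖) ^ (2 * σ) : ℝ) : ℂ))).re := by
  rw [fracLaplacian, Real.fourierInv_eq']
  congr 1
  refine integral_congr_ae (Filter.Eventually.of_forall fun ξ => ?_)
  simp only [smul_eq_mul]
  rw [real_inner_comm, mul_comm (𝓕 (fun y => (φ y : ℂ)) ξ)]
  congr 2
  push_cast; ring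

lemma norm_exp_two_pi_I_inner {n : ℕ} (x ξ : EuclideanSpace ℝ (Fin n)) :
    ‖Complex.exp (2 * Real.pi * Complex.I * (inner ℝ x ξ : ℝ))‖ = 1 := by
  rw [Complex.norm_exp]; simp

lemma abs_fracLaplacian_le {n : ℕ} (σ : ℝ) (φ : EuclideanSpace ℝ (Fin n) → ℝ)
    (x : EuclideanSpace ℝ (Fin n)) :
    |fracLaplacian σ φ x| ≤
      ∫ ξ, (2 * Real.pi * ‖ξ‖) ^ (2 * σ) * ‖𝓕 (fun y => (φ y : ℂ)) ξ‖ := by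
  rw [fracLaplacian_eq_re_integral]
  refine (Complex.abs_re_le_norm _).trans ((norm_integral_le_integral_norm _).trans (le_of_eq ?_))
  refine integral_congr_ae (Filter.Eventually.of_forall fun ξ => ?_)
  simp only [norm_mul, norm_exp_two_pi_I_inner, Complex.norm_real]
  rw [Real.norm_of_nonneg (by positivity)]; ring

/-- The symbol is a superposition over `r` of `(1 - e^{-r l})^N` with `l = (2π‖ξ‖)^2`. After
exchanging the integrals, each `r` contributes a Gaussian in `d`, and integrating against `r ^ (-1 -
σ)` leaves the power of `d`. -/
lemma exists_abs_fracLaplacian_le_of_dist_support {n : ℕ} {σ : ℝ} (hσ : 0 < σ) :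
    ∃ C ≥ (0 : ℝ), ∀ φ : EuclideanSpace ℝ (Fin n) → ℝ, ContDiff ℝ ∞ φ → HasCompactSupport φ →
      ∀ (x : EuclideanSpace ℝ (Fin n)) (d : ℝ), 0 < d → (∀ y, φ y ≠ 0 → d ≤ ‖x - y‖) →
      |fracLaplacian σ φ x| ≤ C * (∫ y, |φ y|) * d ^ (-(n + 2 * σ)) := by
  obtain ⟨N, hN⟩ := exists_nat_gt σ
  obtain ⟨c, hc, hcl⟩ := exists_integral_one_sub_exp_neg_mul_pow hσ hN
  -- The exponent `σ + n / 2` joins the heat kernel factor `r ^ (-n/2)` to the weight `r ^ (-1 -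
  -- σ)`.
  obtain ⟨C, hC, hCd⟩ := exists_integral_rpow_mul_exp_neg_div (a := σ + n / 2)
    (b := 1 / (4 * ((N : ℝ) + 1))) (by positivity) (by positivity)
  refine ⟨c⁻¹ * (2 ^ N * C), by positivity, fun φ hφ hφ' x d hd hx => ?_⟩
  set f : EuclideanSpace ℝ (Fin n) → ℂ := fun y => (φ y : ℂ) with hf
  have hfs : ContDiff ℝ ∞ f := Complex.ofRealCLM.contDiff.comp hφ
  have hfc : HasCompactSupport f := hφ'.comp_left (g := fun r : ℝ => (r : ℂ)) (by simp)
  have hFc : Continuous (𝓕 f) := by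
    have := (𝓕 (hfc.toSchwartzMap hfs)).continuous
    rw [SchwartzMap.fourier_coe] at this
    exact this
  have hFi := integrable_rpow_norm_mul_fourier hfs hfc (a := 2 * σ) (by positivity)
  set m : EuclideanSpace ℝ (Fin n) → ℝ → ℝ := fun ξ r =>
    (1 - Real.exp (-(r * (2 * Real.pi * ‖ξ‖) ^ 2))) ^ N with hm
  set e : EuclideanSpace ℝ (Fin n) → ℂ :=
    fun ξ => Complex.exp (2 * Real.pi * Complex.I * (inner ℝ x ξ : ℝ)) with he
  have hm0 : ∀ ξ r, 0 < r → 0 ≤ m ξ r := fun ξ r hr => by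
    refine pow_nonneg (sub_nonneg.2 (Real.exp_le_one_iff.2 ?_)) _
    have : 0 ≤ r * (2 * Real.pi * ‖ξ‖) ^ 2 := by positivity
    linarith
  have hint : ∀ ξ, IntegrableOn (fun r => m ξ r * r ^ (-1 - σ)) (Ioi 0) := fun ξ =>
    integrableOn_one_sub_exp_neg_mul_pow hσ hN (sq_nonneg (2 * Real.pi * ‖ξ‖))
  have hval : ∀ ξ, ∫ r in Ioi (0 : ℝ), m ξ r * r ^ (-1 - σ) =
      c * (2 * Real.pi * ‖ξ‖) ^ (2 * σ) := fun ξ => by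
    rw [hm, hcl _ (sq_nonneg _), ← Real.rpow_natCast, ← Real.rpow_mul (by positivity)]
    norm_num
  set G : EuclideanSpace ℝ (Fin n) × ℝ → ℂ := fun z =>
    e z.1 * 𝓕 f z.1 * ((m z.1 z.2 * z.2 ^ (-1 - σ) : ℝ) : ℂ) with hG
  have hGm : AEStronglyMeasurable G ((volume : Measure (EuclideanSpace ℝ (Fin n))).prod
      (volume.restrict (Ioi 0))) := by
    have h1 : Measurable fun z : EuclideanSpace ℝ (Fin n) × ℝ => m z.1 z.2 * z.2 ^ (-1 - σ) := by
      simp only [hm]; fun_prop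
    have h2 : Continuous e := by fun_prop
    exact (((h2.mul hFc).measurable.comp measurable_fst).mul
      (Complex.measurable_ofReal.comp h1)).aestronglyMeasurable
  have hGi : Integrable G ((volume : Measure (EuclideanSpace ℝ (Fin n))).prod
      (volume.restrict (Ioi 0))) := by
    rw [integrable_prod_iff hGm]
    refine ⟨Filter.Eventually.of_forall fun ξ => ((hint ξ).ofReal (𝕜 := ℂ)).const_mul (e ξ * 𝓕 f ξ), ?_⟩
    refine (hFi.const_mul c).congr (Filter.Eventually.of_forall fun ξ => ?_)
    have : ∫ r in Ioi (0 : ℝ), ‖G (ξ, r)‖ = ∫ r in Ioi (0 : ℝ), ‖𝓕 f ξ‖ * (m ξ r * r ^ (-1 - σ)) := by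
      refine setIntegral_congr_fun measurableSet_Ioi fun r hr => ?_
      have hr : 0 < r := hr
      simp only [hG, he, norm_mul, norm_exp_two_pi_I_inner, one_mul, Complex.norm_real]
      rw [Real.norm_of_nonneg (hm0 ξ r hr), Real.norm_of_nonneg (by positivity)]
    simp only
    rw [this, integral_const_mul, hval]; ring
  have hswap := integral_integral_swap (f := fun ξ r => G (ξ, r)) hGi
  have hleft : ∫ ξ, ∫ r in Ioi (0 : ℝ), G (ξ, r) =
      c * ∫ ξ, e ξ * (𝓕 f ξ * (((2 * Real.pi * ‖ξ‖) ^ (2 * σ) : ℝ) : ℂ)) := by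
    rw [← integral_const_mul]
    refine integral_congr_ae (Filter.Eventually.of_forall fun ξ => ?_)
    simp only [hG]
    rw [integral_const_mul, integral_complex_ofReal, hval]
    push_cast; ring
  have hright : ‖∫ r in Ioi (0 : ℝ), ∫ ξ, G (ξ, r)‖ ≤
      2 ^ N * (∫ y, |φ y|) * (C * d ^ (-(2 * (σ + n / 2)))) := by
    obtain ⟨hi, hv⟩ := hCd d hd
    rw [← hv, ← integral_const_mul]
    refine norm_integral_le_of_norm_le (hi.const_mul _) ?_
    filter_upwards [ae_restrict_mem measurableSet_Ioi] with r hr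
    have hr : 0 < r := hr
    have h1 : ∫ ξ, G (ξ, r) = (∫ ξ, e ξ * (𝓕 f ξ * ((m ξ r : ℝ) : ℂ))) * ((r ^ (-1 - σ) : ℝ) : ℂ) := by
      rw [← integral_mul_const]
      refine integral_congr_ae (Filter.Eventually.of_forall fun ξ => ?_)
      simp only [hG]; push_cast; ring
    have h2 := norm_integral_one_sub_exp_pow_mul_fourier_le hfs hfc (N := N) hd (x := x)
      (fun y hy => hx y (by simpa [hf] using hy)) hr
    have h3 : ∫ y, ‖f y‖ = ∫ y, |φ y| := by simp [hf]
    rw [h3] at h2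
    rw [h1, norm_mul, Complex.norm_real, Real.norm_of_nonneg (by positivity)]
    refine (mul_le_mul_of_nonneg_right h2 (by positivity)).trans (le_of_eq ?_)
    rw [show -1 - (σ + n / 2) = -((n : ℝ) / 2) + (-1 - σ) by ring, Real.rpow_add hr]
    ring
  rw [← hswap, hleft, norm_mul, Complex.norm_real, Real.norm_of_nonneg hc.le] at hright
  rw [fracLaplacian_eq_re_integral]
  refine (Complex.abs_re_le_norm _).trans ?_
  rw [show -((n : ℝ) + 2 * σ) = -(2 * (σ + n / 2)) by ring]
  calc _ ≤ c⁻¹ * (2 ^ N * (∫ y, |φ y|) * (C * d ^ (-(2 * (σ + n / 2))))) := by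
        rw [le_inv_mul_iff₀ hc]; exact hright
    _ = _ := by ring

/-- Spatial decay of the fractional Laplacian of a test function. -/
theorem exists_abs_fracLaplacian_le {n : ℕ} {σ : ℝ} (hσ : 0 < σ)
    {φ : EuclideanSpace ℝ (Fin n) → ℝ} (hφ : ContDiff ℝ ∞ φ) (hφ' : HasCompactSupport φ) :
    ∃ C ≥ (0 : ℝ), ∀ x, |fracLaplacian σ φ x| ≤ C * (1 + ‖x‖) ^ (-(n + 2 * σ)) := by
  obtain ⟨C, hC, hCd⟩ := exists_abs_fracLaplacian_le_of_dist_support (n := n) hσ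
  obtain ⟨ρ, hρ, hsupp⟩ := hφ'.isBounded.subset_closedBall_lt 1 0
  set C₁ := ∫ ξ, (2 * Real.pi * ‖ξ‖) ^ (2 * σ) * ‖𝓕 (fun y => (φ y : ℂ)) ξ‖ with hC₁
  have hC₁0 : 0 ≤ C₁ := integral_nonneg fun ξ => by positivity
  set I := ∫ y, |φ y| with hI
  have hI0 : 0 ≤ I := integral_nonneg fun y => abs_nonneg _
  set q : ℝ := n + 2 * σ with hq
  have hq0 : 0 < q := by positivity
  have hC₁x := abs_fracLaplacian_le σ φ
  rw [← hC₁] at hC₁x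
  clear_value C₁ I q
  refine ⟨C₁ * (1 + 2 * ρ) ^ q + C * I * 4 ^ q, by positivity, fun x => ?_⟩
  have hx1 : 0 < 1 + ‖x‖ := by positivity
  -- Far out, the distance to the support is at least `‖x‖ / 2`, so the previous lemma applies; on
  -- the remaining bounded set the uniform Fourier bound `C₁` is enough.
  rcases le_or_gt (2 * ρ) ‖x‖ with h | h
  · have hd : 0 < ‖x‖ / 2 := by linarith
    have h1 := hCd φ hφ hφ' x (‖x‖ / 2) hd fun y hy => by
      have hy' : ‖y‖ ≤ ρ := by
        simpa using hsupp (subset_tsupport _ (Function.mem_support.2 hy))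
      have := norm_sub_norm_le x y
      linarith
    rw [← hI] at h1
    have h2 : (‖x‖ / 2) ^ (-q) ≤ 4 ^ q * (1 + ‖x‖) ^ (-q) := by
      rw [Real.rpow_neg hx1.le, ← div_eq_mul_inv, ← Real.div_rpow (by norm_num) hx1.le,
        ← inv_div (1 + ‖x‖) 4, Real.inv_rpow (by positivity), ← Real.rpow_neg (by positivity)]
      exact Real.rpow_le_rpow_of_nonpos (by positivity) (by linarith) (by linarith)
    calc _ ≤ C * I * (‖x‖ / 2) ^ (-q) := h1
      _ ≤ C * I * (4 ^ q * (1 + ‖x‖) ^ (-q)) := by gcongr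
      _ ≤ _ := by
        rw [← mul_assoc]
        refine mul_le_mul_of_nonneg_right (le_add_of_nonneg_left (by positivity)) (by positivity)
  · have h2 : 1 ≤ (1 + 2 * ρ) ^ q * (1 + ‖x‖) ^ (-q) := by
      rw [Real.rpow_neg hx1.le, ← div_eq_mul_inv, ← Real.div_rpow (by positivity) hx1.le]
      refine Real.one_le_rpow ?_ hq0.le
      rw [one_le_div hx1]; linarith
    calc _ ≤ C₁ := hC₁x x
      _ ≤ C₁ * ((1 + 2 * ρ) ^ q * (1 + ‖x‖) ^ (-q)) := le_mul_of_one_le_right hC₁0 h2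
      _ ≤ _ := by
        rw [← mul_assoc]
        refine mul_le_mul_of_nonneg_right (le_add_of_nonneg_right (by positivity)) (by positivity)

lemma continuous_fracLaplacian {n : ℕ} {σ : ℝ} (hσ : 0 < σ)
    {φ : EuclideanSpace ℝ (Fin n) → ℝ} (hφ : ContDiff ℝ ∞ φ) (hφ' : HasCompactSupport φ) :
    Continuous (fracLaplacian σ φ) := by
  have hfs : ContDiff ℝ ∞ (fun y => (φ y : ℂ)) := Complex.ofRealCLM.contDiff.comp hφ
  have hfc : HasCompactSupport (fun y => (φ y : ℂ)) :=
    hφ'.comp_left (g := fun r : ℝ => (r : ℂ)) (by simp)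
  have hFi := integrable_rpow_norm_mul_fourier hfs hfc (a := 2 * σ) (by positivity)
  have hFc : Continuous (𝓕 (fun y => (φ y : ℂ))) := by
    have := (𝓕 (hfc.toSchwartzMap hfs)).continuous
    rw [SchwartzMap.fourier_coe] at this
    exact this
  have : fracLaplacian σ φ = fun x => (∫ ξ,
      Complex.exp (2 * Real.pi * Complex.I * (inner ℝ x ξ : ℝ)) *
      (𝓕 (fun y => (φ y : ℂ)) ξ * (((2 * Real.pi * ‖ξ‖) ^ (2 * σ) : ℝ) : ℂ))).re :=
    funext fun x => fracLaplacian_eq_re_integral σ φ x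
  rw [this]
  refine Complex.continuous_re.comp (continuous_of_dominated (bound := fun ξ =>
    (2 * Real.pi * ‖ξ‖) ^ (2 * σ) * ‖𝓕 (fun y => (φ y : ℂ)) ξ‖) (fun x => ?_)
    (fun x => Filter.Eventually.of_forall fun ξ => ?_) hFi
    (Filter.Eventually.of_forall fun ξ => by fun_prop))
  · have h1 : Continuous fun ξ : EuclideanSpace ℝ (Fin n) => (2 * Real.pi * ‖ξ‖) ^ (2 * σ) :=
      (continuous_const.mul continuous_norm).rpow_const fun _ => Or.inr (by positivity)
    have : Continuous fun ξ => Complex.exp (2 * Real.pi * Complex.I * (inner ℝ x ξ : ℝ)) *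
      (𝓕 (fun y => (φ y : ℂ)) ξ * (((2 * Real.pi * ‖ξ‖) ^ (2 * σ) : ℝ) : ℂ)) := by fun_prop
    exact this.aestronglyMeasurable
  · simp only [norm_mul, norm_exp_two_pi_I_inner, Complex.norm_real]
    rw [Real.norm_of_nonneg (by positivity)]
    exact le_of_eq (by ring)

/-! ### Scaling and translation of the fractional Laplacian -/

lemma fourier_comp_inv_smul_sub {n : ℕ} (f : EuclideanSpace ℝ (Fin n) → ℂ) {R : ℝ} (hR : 0 < R)
    (y ξ : EuclideanSpace ℝ (Fin n)) :
    𝓕 (fun v => f (R⁻¹ • v - y)) ξ = (R : ℂ) ^ n *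
      (Complex.exp (-2 * Real.pi * Complex.I * (inner ℝ (R • y) ξ : ℝ)) * 𝓕 f (R • ξ)) := by
  rw [Real.fourier_eq', Real.fourier_eq']
  set G : EuclideanSpace ℝ (Fin n) → ℂ := fun w =>
    Complex.exp (((-2 * Real.pi * inner ℝ (R • (w + y)) ξ : ℝ) : ℂ) * Complex.I) * f w with hG
  have h1 : ∀ v : EuclideanSpace ℝ (Fin n),
      Complex.exp (((-2 * Real.pi * inner ℝ v ξ : ℝ) : ℂ) * Complex.I) • f (R⁻¹ • v - y) =
        G (R⁻¹ • v - y) := by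
    intro v
    simp only [hG, sub_add_cancel, smul_smul, mul_inv_cancel₀ hR.ne', one_smul, smul_eq_mul]
  simp_rw [h1]
  rw [Measure.integral_comp_inv_smul volume (fun w => G (w - y)) R, integral_sub_right_eq_self,
    finrank_euclideanSpace_fin, abs_of_pos (by positivity), Complex.real_smul]
  push_cast
  congr 1
  rw [← integral_const_mul]
  refine integral_congr_ae (Filter.Eventually.of_forall fun w => ?_)
  simp only [hG, smul_eq_mul]
  rw [← mul_assoc, ← Complex.exp_add, smul_add, inner_add_left, inner_smul_left, inner_smul_right]
  congr 2
  push_cast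
  simp
  ring

/-- The symbol is homogeneous of degree `2σ`. The resulting gain `R ^ (-2σ)` equals the gain `1 / L`
from time derivatives when `L = R ^ (2σ)`. -/
lemma fracLaplacian_comp_inv_smul_sub {n : ℕ} (σ : ℝ) (φ : EuclideanSpace ℝ (Fin n) → ℝ)
    {R : ℝ} (hR : 0 < R) (x y : EuclideanSpace ℝ (Fin n)) :
    fracLaplacian σ (fun v => φ (R⁻¹ • v - y)) x =
      R ^ (-(2 * σ)) * fracLaplacian σ φ (R⁻¹ • x - y) := by
  rw [fracLaplacian_eq_re_integral, fracLaplacian_eq_re_integral]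
  set f : EuclideanSpace ℝ (Fin n) → ℂ := fun v => (φ v : ℂ) with hf
  set K : EuclideanSpace ℝ (Fin n) → ℂ := fun ζ =>
    Complex.exp (2 * Real.pi * Complex.I * (inner ℝ (R⁻¹ • x - y) ζ : ℝ)) *
      (𝓕 f ζ * (((2 * Real.pi * ‖ζ‖) ^ (2 * σ) : ℝ) : ℂ)) with hK
  have h1 : ∀ ξ : EuclideanSpace ℝ (Fin n),
      Complex.exp (2 * Real.pi * Complex.I * (inner ℝ x ξ : ℝ)) *
      (𝓕 (fun v => f (R⁻¹ • v - y)) ξ * (((2 * Real.pi * ‖ξ‖) ^ (2 * σ) : ℝ) : ℂ)) =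
      ((R ^ n * R ^ (-(2 * σ)) : ℝ) : ℂ) * K (R • ξ) := by
    intro ξ
    rw [fourier_comp_inv_smul_sub f hR]
    simp only [hK]
    have e1 : (2 * Real.pi * ‖R • ξ‖) ^ (2 * σ) = R ^ (2 * σ) * (2 * Real.pi * ‖ξ‖) ^ (2 * σ) := by
      rw [norm_smul, Real.norm_of_nonneg hR.le, ← Real.mul_rpow hR.le (by positivity)]
      congr 1; ring
    have e2 : Complex.exp (2 * Real.pi * Complex.I * (inner ℝ (R⁻¹ • x - y) (R • ξ) : ℝ)) =
        Complex.exp (2 * Real.pi * Complex.I * (inner ℝ x ξ : ℝ)) *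
        Complex.exp (-2 * Real.pi * Complex.I * (inner ℝ (R • y) ξ : ℝ)) := by
      rw [← Complex.exp_add, inner_sub_left, inner_smul_left, inner_smul_left, inner_smul_right,
        inner_smul_right]
      congr 1
      have : (R : ℂ) ≠ 0 := by exact_mod_cast hR.ne'
      push_cast
      simp
      field_simp
      ring
    have e3 : ((R ^ (-(2 * σ)) : ℝ) : ℂ) * ((R ^ (2 * σ) : ℝ) : ℂ) = 1 := by
      rw [← Complex.ofReal_mul, ← Real.rpow_add hR]; simp
    rw [e1, e2]
    push_cast
    linear_combination (-(R : ℂ) ^ n *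
      Complex.exp (2 * Real.pi * Complex.I * (inner ℝ x ξ : ℝ)) *
        Complex.exp (-2 * Real.pi * Complex.I * (inner ℝ (R • y) ξ : ℝ)) * 𝓕 f (R • ξ) *
        (((2 * Real.pi * ‖ξ‖) ^ (2 * σ) : ℝ) : ℂ)) * e3
  refine (congrArg Complex.re
    (integral_congr_ae (μ := volume) (Filter.Eventually.of_forall h1))).trans ?_
  rw [integral_const_mul, Measure.integral_comp_smul volume K R, finrank_euclideanSpace_fin,
    abs_of_pos (by positivity), Complex.real_smul, ← mul_assoc, ← Complex.ofReal_mul,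
    Complex.re_ofReal_mul]
  congr 1
  have : (R ^ n) ≠ 0 := by positivity
  field_simp

/-! ### Time cutoffs -/

/-- Each differentiation of a power costs at most one factor of `f`; what accumulates besides is
smooth. -/
lemma exists_iteratedDeriv_pow_eq {f : ℝ → ℝ} (hf : ContDiff ℝ ∞ f) (j k : ℕ) (hjk : j ≤ k) :
    ∃ h : ℝ → ℝ, ContDiff ℝ ∞ h ∧
      iteratedDeriv j (fun t => f t ^ k) = fun t => f t ^ (k - j) * h t := by
  induction j with
  | zero => exact ⟨fun _ => 1, contDiff_const, by simp⟩
  | succ j ih =>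
    obtain ⟨h, hh, he⟩ := ih (by omega)
    have hf1 : ContDiff ℝ ∞ (deriv f) := (contDiff_infty_iff_deriv.1 hf).2
    have hh1 : ContDiff ℝ ∞ (deriv h) := (contDiff_infty_iff_deriv.1 hh).2
    refine ⟨fun t => ((k - j : ℕ) : ℝ) * deriv f t * h t + f t * deriv h t,
      ((contDiff_const.mul hf1).mul hh).add (hf.mul hh1), ?_⟩
    rw [iteratedDeriv_succ, he]
    funext t
    have h1 : HasDerivAt f (deriv f t) t := (hf.differentiable (by simp) t).hasDerivAt
    have h2 : HasDerivAt h (deriv h t) t := (hh.differentiable (by simp) t).hasDerivAt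
    refine (((h1.pow (k - j)).mul h2).deriv).trans ?_
    have e1 : k - j = (k - (j + 1)) + 1 := by omega
    simp only
    rw [show k - j - 1 = k - (j + 1) by omega, Pi.pow_apply, show f t ^ (k - j) = f t ^ (k - (j + 1)) * f t by
      rw [← pow_succ, ← e1]]
    ring

/-- A high power of a cutoff vanishes so flatly that its derivatives are controlled by a fractional
power of itself: since `0 ≤ f ≤ 1`, the leftover `f ^ (k - j)` is at most `f ^ (k * a)`. -/
lemma exists_bound_iteratedDeriv_pow {f : ℝ → ℝ} (hf : ContDiff ℝ ∞ f)
    (hfc : HasCompactSupport f) (hf0 : ∀ t, 0 ≤ f t) (hf1 : ∀ t, f t ≤ 1) {a : ℝ}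
    {j k : ℕ} (hjk : j < k) (hk : (k : ℝ) * a ≤ k - j) :
    ∃ C ≥ (0 : ℝ), ∀ t, |iteratedDeriv j (fun t => f t ^ k) t| ≤ C * (f t ^ k) ^ a := by
  obtain ⟨h, hh, he⟩ := exists_iteratedDeriv_pow_eq hf j k hjk.le
  obtain ⟨C, hC⟩ := hfc.isCompact.exists_bound_of_continuousOn hh.continuous.continuousOn
  refine ⟨max C 0, le_max_right _ _, fun t => ?_⟩
  rw [he]
  simp only
  by_cases ht : f t = 0
  · rw [ht, zero_pow (by omega), zero_mul, abs_zero]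
    positivity
  have hft : 0 < f t := lt_of_le_of_ne (hf0 t) (Ne.symm ht)
  have h1 : f t ^ (k - j) ≤ (f t ^ k) ^ a := by
    rw [← Real.rpow_natCast, ← Real.rpow_natCast, ← Real.rpow_mul hft.le, Nat.cast_sub hjk.le]
    exact Real.rpow_le_rpow_of_exponent_ge hft (hf1 t) hk
  have h2 : |h t| ≤ max C 0 := (hC t (subset_tsupport _ ht)).trans (le_max_left _ _)
  rw [abs_mul, abs_of_nonneg (by positivity), mul_comm]
  exact mul_le_mul h2 h1 (by positivity) (le_max_right _ _)

/-- Smooth cutoffs in time at scale `L`, whose derivatives are controlled by a power `1 / p` of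
the cutoff itself. -/
lemma exists_time_cutoff {a : ℝ} (ha : a < 1) :
    ∃ C ≥ (0 : ℝ), ∀ L : ℝ, 1 ≤ L → ∃ κ : ℝ → ℝ, ContDiff ℝ ∞ κ ∧ HasCompactSupport κ ∧
      (∀ t, 2 * L ≤ t → κ t = 0) ∧ (∀ t, 0 ≤ κ t) ∧ (∀ t, κ t ≤ 1) ∧ κ 0 = 1 ∧ deriv κ 0 = 0 ∧
      (∀ t, 0 < t → deriv κ t ≤ 0) ∧ (∀ t, |deriv κ t| ≤ C / L * κ t ^ a) ∧
      (∀ t, |iteratedDeriv 2 (κ - deriv κ) t| ≤ C / L * κ t ^ a) ∧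
      (∀ t, |κ t - deriv κ t| ≤ C * κ t ^ a) := by
  set θ : ℝ → ℝ := fun t => Real.smoothTransition (2 - t) * Real.smoothTransition (2 + t) with hθ
  have hst : ContDiff ℝ ∞ Real.smoothTransition := Real.smoothTransition.contDiff
  have hθs : ContDiff ℝ ∞ θ :=
    (hst.comp (contDiff_const.sub contDiff_id)).mul (hst.comp (contDiff_const.add contDiff_id))
  have hθ0 : ∀ t, 0 ≤ θ t := fun t =>
    mul_nonneg (Real.smoothTransition.nonneg _) (Real.smoothTransition.nonneg _)
  have hθ1 : ∀ t, θ t ≤ 1 := fun t =>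
    mul_le_one₀ (Real.smoothTransition.le_one _) (Real.smoothTransition.nonneg _)
      (Real.smoothTransition.le_one _)
  have hθz : ∀ t, 2 ≤ t → θ t = 0 := fun t ht => by
    rw [hθ]; simp only; rw [Real.smoothTransition.zero_of_nonpos (by linarith), zero_mul]
  have hθc : HasCompactSupport θ := by
    refine HasCompactSupport.intro (isCompact_Icc (a := -2) (b := 2)) fun t ht => ?_
    rcases not_and_or.1 ht with h | h
    · rw [hθ]; simp only
      rw [Real.smoothTransition.zero_of_nonpos (x := 2 + t) (by linarith), mul_zero]
    · exact hθz t (by linarith)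
  have hθone : ∀ t, |t| ≤ 1 → θ t = 1 := fun t ht => by
    rw [abs_le] at ht
    rw [hθ]; simp only
    rw [Real.smoothTransition.one_of_one_le (by linarith),
      Real.smoothTransition.one_of_one_le (by linarith), one_mul]
  have hθanti : AntitoneOn θ (Ici (-1)) := by
    intro s hs t ht hst
    simp only [mem_Ici] at hs ht
    rw [hθ]; simp only
    rw [Real.smoothTransition.one_of_one_le (x := 2 + s) (by linarith),
      Real.smoothTransition.one_of_one_le (x := 2 + t) (by linarith), mul_one, mul_one]
    exact Real.smoothTransition.monotone (by linarith)
  -- Third derivatives occur because `κ - κ'` is differentiated twice; the choice of `k` ensures `k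
  -- * a ≤ k - 3`.
  obtain ⟨k, hk⟩ := exists_nat_gt (max 3 (3 / (1 - a)))
  have hk3 : (3 : ℝ) < k := (le_max_left _ _).trans_lt hk
  have hk3' : 3 < k := by exact_mod_cast hk3
  have hka : (k : ℝ) * a ≤ k - 3 := by
    have := ((le_max_right _ _).trans_lt hk).le
    rw [div_le_iff₀ (by linarith)] at this
    linarith
  set χ : ℝ → ℝ := fun t => θ t ^ k with hχ
  have hχs : ContDiff ℝ ∞ χ := hθs.pow k
  have hb : ∀ j : ℕ, j ≤ 3 → ∃ C ≥ (0 : ℝ), ∀ t, |iteratedDeriv j χ t| ≤ C * χ t ^ a := by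
    intro j hj
    refine exists_bound_iteratedDeriv_pow hθs hθc hθ0 hθ1 (by omega) ?_
    have : (j : ℝ) ≤ 3 := by exact_mod_cast hj
    linarith
  obtain ⟨C0, hC0, h0⟩ := hb 0 (by omega)
  obtain ⟨C1, hC1, h1⟩ := hb 1 (by omega)
  obtain ⟨C2, hC2, h2⟩ := hb 2 (by omega)
  obtain ⟨C3, hC3, h3⟩ := hb 3 (by omega)
  refine ⟨C0 + C1 + C2 + C3, by positivity, fun L hL => ?_⟩
  have hL0 : 0 < L := by linarith
  set l := L⁻¹ with hl
  have hl0 : 0 < l := inv_pos.2 hL0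
  have hl1 : l ≤ 1 := inv_le_one_of_one_le₀ hL
  have hiter : ∀ j : ℕ, ∀ t, iteratedDeriv j (fun t => χ (l * t)) t = l ^ j * iteratedDeriv j χ (l * t) :=
    fun j t => by
      rw [iteratedDeriv_comp_const_mul (contDiff_infty.1 hχs j)]
  have hκs : ContDiff ℝ ∞ (fun t => χ (l * t)) := hχs.comp (contDiff_const.mul contDiff_id)
  have hd : ∀ t, deriv (fun t => χ (l * t)) t = l * iteratedDeriv 1 χ (l * t) := fun t => by
    have := hiter 1 t
    rwa [iteratedDeriv_one, pow_one] at this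
  refine ⟨fun t => χ (l * t), hκs, ?_, ?_, ?_, ?_, ?_, ?_, ?_, ?_, ?_, ?_⟩
  · refine HasCompactSupport.intro (isCompact_closedBall (0 : ℝ) (2 * L)) fun t ht => ?_
    have : |t| > 2 * L := by simpa using ht
    have h2t : 2 < |l * t| := by
      rw [abs_mul, abs_of_pos hl0, hl, lt_inv_mul_iff₀ hL0]; linarith
    have : θ (l * t) = 0 := by
      rcases lt_abs.1 h2t with h | h
      · exact hθz _ h.le
      · rw [hθ]; simp only
        rw [Real.smoothTransition.zero_of_nonpos (x := 2 + l * t) (by linarith), mul_zero]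
    simp only [hχ, this]
    exact zero_pow (by omega)
  · intro t ht
    have : θ (l * t) = 0 := hθz _ (by rw [hl, le_inv_mul_iff₀ hL0]; linarith)
    simp only [hχ, this]
    exact zero_pow (by omega)
  · exact fun t => pow_nonneg (hθ0 _) _
  · exact fun t => pow_le_one₀ (hθ0 _) (hθ1 _)
  · simp [hχ, hθone 0]
  · have : (fun t => χ (l * t)) =ᶠ[nhds 0] fun _ => (1 : ℝ) := by
      have hmem : Metric.ball (0 : ℝ) 1 ∈ nhds (0 : ℝ) := Metric.ball_mem_nhds _ one_pos
      filter_upwards [hmem] with t ht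
      have ht : |t| < 1 := by simpa using ht
      have : θ (l * t) = 1 := hθone _ (by
        rw [abs_mul, abs_of_pos hl0]; nlinarith [abs_nonneg t])
      simp only [hχ, this, one_pow]
    rw [this.deriv_eq]; simp
  · intro t ht
    have hanti : AntitoneOn (fun t => χ (l * t)) (Ici (0 : ℝ)) := by
      intro s hs t ht hst
      simp only [mem_Ici] at hs ht
      have := hθanti (a := l * s) (b := l * t)
        (mem_Ici.2 (by have : 0 ≤ l * s := by positivity
                       linarith))
        (mem_Ici.2 (by have : 0 ≤ l * t := by positivity
                       linarith)) (by gcongr)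
      exact pow_le_pow_left₀ (hθ0 _) this k
    rw [← derivWithin_of_mem_nhds (Ici_mem_nhds ht)]
    exact hanti.derivWithin_nonpos
  · intro t
    have hχa : 0 ≤ χ (l * t) ^ a := Real.rpow_nonneg (pow_nonneg (hθ0 _) _) _
    rw [hd, abs_mul, abs_of_pos hl0, div_eq_mul_inv, ← hl]
    have := h1 (l * t)
    calc _ ≤ l * (C1 * χ (l * t) ^ a) := by gcongr
      _ ≤ l * ((C0 + C1 + C2 + C3) * χ (l * t) ^ a) := by gcongr; linarith
      _ = _ := by ring
  · intro t
    have hχa : 0 ≤ χ (l * t) ^ a := Real.rpow_nonneg (pow_nonneg (hθ0 _) _) _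
    have hκd : ContDiff ℝ ∞ (deriv fun t => χ (l * t)) := (contDiff_infty_iff_deriv.1 hκs).2
    have e : iteratedDeriv 2 ((fun t => χ (l * t)) - deriv fun t => χ (l * t)) t =
        l ^ 2 * iteratedDeriv 2 χ (l * t) - l ^ 3 * iteratedDeriv 3 χ (l * t) := by
      rw [iteratedDeriv_sub (contDiff_infty.1 hκs 2).contDiffAt (contDiff_infty.1 hκd 2).contDiffAt, ← iteratedDeriv_succ', hiter, hiter]
    rw [e, div_eq_mul_inv, ← hl]
    -- As `L ≥ 1`, second and third derivatives gain at least the single factor `1 / L` that is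
    -- needed.
    have hl2 : l ^ 2 ≤ l := by nlinarith
    have hl3 : l ^ 3 ≤ l := by nlinarith
    calc _ ≤ |l ^ 2 * iteratedDeriv 2 χ (l * t)| + |l ^ 3 * iteratedDeriv 3 χ (l * t)| := abs_sub _ _
      _ = l ^ 2 * |iteratedDeriv 2 χ (l * t)| + l ^ 3 * |iteratedDeriv 3 χ (l * t)| := by
        rw [abs_mul, abs_mul, abs_of_pos (by positivity : 0 < l ^ 2),
          abs_of_pos (by positivity : 0 < l ^ 3)]
      _ ≤ l * (C2 * χ (l * t) ^ a) + l * (C3 * χ (l * t) ^ a) := by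
        gcongr
        · exact h2 _
        · exact h3 _
      _ ≤ l * (C2 * χ (l * t) ^ a) + l * (C3 * χ (l * t) ^ a) +
          (l * (C0 * χ (l * t) ^ a) + l * (C1 * χ (l * t) ^ a)) :=
        le_add_of_nonneg_right (by positivity)
      _ = _ := by ring
  · intro t
    have hχa : 0 ≤ χ (l * t) ^ a := Real.rpow_nonneg (pow_nonneg (hθ0 _) _) _
    have e0 := h0 (l * t)
    have e1 := h1 (l * t)
    rw [iteratedDeriv_zero] at e0
    rw [hd]
    calc _ ≤ |χ (l * t)| + |l * iteratedDeriv 1 χ (l * t)| := abs_sub _ _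
      _ ≤ C0 * χ (l * t) ^ a + 1 * (C1 * χ (l * t) ^ a) := by
        rw [abs_mul, abs_of_pos hl0]; gcongr
      _ ≤ C0 * χ (l * t) ^ a + 1 * (C1 * χ (l * t) ^ a) +
          (C2 * χ (l * t) ^ a + C3 * χ (l * t) ^ a) := le_add_of_nonneg_right (by positivity)
      _ = _ := by ring

/-! ### Lattice weights -/

/-- A discrete covering of space together with summable weights dominating
`(1 + ‖x‖) ^ (-q)`. -/
lemma exists_lattice_weights (n : ℕ) {q : ℝ} (hq : (n : ℝ) < q) :
    ∃ (ι : Type) (_ : Countable ι) (k : ι → EuclideanSpace ℝ (Fin n)) (w : ι → ℝ),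
      (∀ i, 0 ≤ w i) ∧ Summable w ∧
      ∀ z, ∃ i, ‖z - k i‖ ≤ n ∧ (1 + ‖z‖) ^ (-q) ≤ w i := by
  have hq0 : 0 < q := lt_of_le_of_lt (Nat.cast_nonneg n) hq
  set b := (EuclideanSpace.basisFun (Fin n) ℝ).toBasis with hb
  set L := Submodule.span ℤ (Set.range b) with hL
  refine ⟨L, inferInstance, fun i => (i : EuclideanSpace ℝ (Fin n)),
    -- Rounding down to the integer lattice moves `z` by at most `n`, whence `1 + ‖k‖ ≤ (1 + n) * (1
    -- + ‖z‖)`; this accounts for the constant in the weight.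
    fun i => (1 + (n : ℝ)) ^ q * (1 + ‖(i : EuclideanSpace ℝ (Fin n))‖) ^ (-q),
    fun i => by positivity, ?_, fun z => ⟨ZSpan.floor b z, ?_⟩⟩
  · refine Summable.mul_left _ ?_
    have hs := ZLattice.summable_norm_rpow L (-q) (by
      rw [ZLattice.rank ℝ L, finrank_euclideanSpace_fin]; linarith)
    refine Summable.of_norm_bounded_eventually hs ?_
    have : ({0} : Set L).Finite := Set.finite_singleton 0
    filter_upwards [this.compl_mem_cofinite] with i hi
    have hi0 : 0 < ‖(i : EuclideanSpace ℝ (Fin n))‖ := by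
      rw [norm_pos_iff]; simpa using hi
    rw [Real.norm_of_nonneg (by positivity)]
    exact Real.rpow_le_rpow_of_nonpos hi0 (le_add_of_nonneg_left zero_le_one) (by linarith)
  · have h1 : ‖z - (ZSpan.floor b z : EuclideanSpace ℝ (Fin n))‖ ≤ n := by
      have := ZSpan.norm_fract_le (K := ℝ) b z
      rw [ZSpan.fract_apply] at this
      refine this.trans (le_of_eq ?_)
      simp [hb]
    refine ⟨h1, ?_⟩
    have h2 : ‖(ZSpan.floor b z : EuclideanSpace ℝ (Fin n))‖ ≤ ‖z‖ + n := by
      have := norm_sub_norm_le (ZSpan.floor b z : EuclideanSpace ℝ (Fin n)) z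
      rw [norm_sub_rev] at this
      linarith
    have hz : 0 < 1 + ‖z‖ := by positivity
    have hn : 0 < 1 + (n : ℝ) := by positivity
    have h3 : 1 + ‖(ZSpan.floor b z : EuclideanSpace ℝ (Fin n))‖ ≤ (1 + n) * (1 + ‖z‖) := by
      have : 0 ≤ (n : ℝ) * ‖z‖ := by positivity
      linarith
    calc (1 + ‖z‖) ^ (-q) = (1 + (n : ℝ)) ^ q * ((1 + n) * (1 + ‖z‖)) ^ (-q) := by
          rw [Real.mul_rpow hn.le hz.le, ← mul_assoc, ← Real.rpow_add hn]; simp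
      _ ≤ _ := mul_le_mul_of_nonneg_left
        (Real.rpow_le_rpow_of_nonpos (by positivity) h3 (by linarith)) (by positivity)

/-! ### Semicontinuity of power integrals, memory term and measurability in time -/

lemma integral_mul_eq_inner_toLp {α : Type*} [MeasurableSpace α] {μ : Measure α} {g : α → ℝ}
    (hg : MemLp g 2 μ) (f : Lp ℝ 2 μ) :
    ∫ x, f x * g x ∂μ = inner ℝ (hg.toLp g) f := by
  rw [L2.inner_def]
  refine integral_congr_ae ?_
  filter_upwards [hg.coeFn_toLp] with x hx
  rw [hx]; simp

/-- Lower semicontinuity in `L²` of weighted power integrals. -/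
lemma lowerSemicontinuous_lintegral_enorm_rpow {α : Type*} [MeasurableSpace α] {μ : Measure α}
    {w : α → ENNReal} (hw : Measurable w) {p : ℝ} (hp : 0 ≤ p) :
    LowerSemicontinuous fun f : Lp ℝ 2 μ => ∫⁻ x, ‖f x‖ₑ ^ p * w x ∂μ := by
  rw [lowerSemicontinuous_iff_isClosed_preimage]
  intro y
  refine IsSeqClosed.isClosed fun f g hf hfg => ?_
  have h1 := tendstoInMeasure_of_tendsto_Lp hfg
  obtain ⟨ns, hns, hae⟩ := h1.exists_seq_tendsto_ae
  simp only [mem_preimage, mem_Iic] at hf ⊢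
  have hmeas : ∀ k, AEMeasurable (fun x => ‖f k x‖ₑ ^ p * w x) μ := fun k =>
    (((Lp.aestronglyMeasurable (f k)).enorm).pow_const p).mul hw.aemeasurable
  -- Fatou's lemma along a subsequence converging almost everywhere.
  calc ∫⁻ x, ‖g x‖ₑ ^ p * w x ∂μ
      ≤ ∫⁻ x, Filter.liminf (fun k => ‖f (ns k) x‖ₑ ^ p * w x) Filter.atTop ∂μ := by
        refine lintegral_mono_ae ?_
        filter_upwards [hae] with x hx
        -- Multiplication by `⊤` is not continuous at zero, so infinite weights are treated
        -- separately.
        by_cases hw0 : w x = ⊤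
        · by_cases hg0 : g x = 0 ∧ 0 < p
          · simp [hg0.1, ENNReal.zero_rpow_of_pos hg0.2]
          · have hpos : ∀ᶠ k in Filter.atTop, ‖f (ns k) x‖ₑ ^ p * w x = ⊤ := by
              by_cases hp0 : p = 0
              · exact Filter.Eventually.of_forall fun k => by simp [hp0, hw0]
              · have hpp : 0 < p := lt_of_le_of_ne hp (Ne.symm hp0)
                have hg1 : g x ≠ 0 := fun h => hg0 ⟨h, hpp⟩
                filter_upwards [hx.eventually_ne hg1] with k hk
                rw [hw0, ENNReal.mul_top]
                exact (ENNReal.rpow_pos (by simpa using hk) (by simp)).ne'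
            rw [Filter.liminf_congr hpos]
            simp
        · have : Filter.Tendsto (fun k => ‖f (ns k) x‖ₑ ^ p * w x) Filter.atTop
              (nhds (‖g x‖ₑ ^ p * w x)) := by
            refine ENNReal.Tendsto.mul_const ?_ (Or.inr hw0)
            exact (ENNReal.continuous_rpow_const.tendsto _).comp (hx.enorm)
          rw [this.liminf_eq]
    _ ≤ Filter.liminf (fun k => ∫⁻ x, ‖f (ns k) x‖ₑ ^ p * w x ∂μ) Filter.atTop :=
        lintegral_liminf_le' fun k => hmeas _
    _ ≤ y := by
        refine Filter.liminf_le_of_le (by isBoundedDefault) fun b hb => ?_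
        obtain ⟨k, hk⟩ := hb.exists
        exact hk.trans (hf _)

/-- The damping produced by the memory term: testing `U - g ∗ U` with `κ - κ'` only leaves
`-κ' U`. -/
lemma integral_sub_deriv_mul_memory {U κ : ℝ → ℝ} (hU : Continuous U) (hκ : ContDiff ℝ ∞ κ)
    (hκ' : HasCompactSupport κ) {V : ℝ → ℝ}
    (hV : ∀ t, V t = ∫ τ in (0 : ℝ)..t, Real.exp (-(t - τ)) * U τ) :
    Continuous V ∧ ∫ t in Ioi (0 : ℝ), (κ t - deriv κ t) * (U t - V t) =
      ∫ t in Ioi (0 : ℝ), -(deriv κ t * U t) := by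
  have hV' : V = fun t => Real.exp (-t) * ∫ τ in (0 : ℝ)..t, Real.exp τ * U τ := by
    funext t
    rw [hV, ← intervalIntegral.integral_const_mul]
    refine intervalIntegral.integral_congr fun τ _ => ?_
    rw [← mul_assoc, ← Real.exp_add]
    congr 2; ring
  have hVd : ∀ t, HasDerivAt V (U t - V t) t := by
    intro t
    have h1 : HasDerivAt (fun t => ∫ τ in (0 : ℝ)..t, Real.exp τ * U τ) (Real.exp t * U t) t :=
      (Real.continuous_exp.mul hU).integral_hasStrictDerivAt 0 t |>.hasDerivAt
    have h2 : HasDerivAt (fun t : ℝ => Real.exp (-t)) (-Real.exp (-t)) t := by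
      simpa using (hasDerivAt_neg t).exp
    have h3 := h2.mul h1
    rw [hV']
    refine h3.congr_deriv ?_
    have : Real.exp (-t) * (Real.exp t * U t) = U t := by
      rw [← mul_assoc, ← Real.exp_add]; simp
    rw [this]; ring
  have hVc : Continuous V := continuous_iff_continuousAt.2 fun t => (hVd t).continuousAt
  refine ⟨hVc, ?_⟩
  have hκd : ∀ t, HasDerivAt κ (deriv κ t) t := fun t =>
    (hκ.differentiable (by simp) t).hasDerivAt
  have hκ1 : Continuous (deriv κ) := (contDiff_infty_iff_deriv.1 hκ).2.continuous
  have hκ1' : HasCompactSupport (deriv κ) := hκ'.deriv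
  have hint : ∀ {f g : ℝ → ℝ}, Continuous f → HasCompactSupport f → Continuous g →
      IntegrableOn (fun t => f t * g t) (Ioi 0) := fun hf hf' hg =>
    ((hf.mul hg).integrable_of_hasCompactSupport hf'.mul_right).integrableOn
  -- The integrand is `(κ V)'`, because `V' = U - V`; the boundary terms vanish by `V 0 = 0` and the
  -- compact support of `κ`.
  have hprod : ∫ t in Ioi (0 : ℝ), (deriv κ t * V t + κ t * (U t - V t)) = 0 := by
    have hd : ∀ t, HasDerivAt (fun t => κ t * V t) (deriv κ t * V t + κ t * (U t - V t)) t :=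
      fun t => (hκd t).mul (hVd t)
    have hzero : Filter.Tendsto (fun t => κ t * V t) Filter.atTop (nhds 0) := by
      have : HasCompactSupport fun t => κ t * V t := hκ'.mul_right
      exact this.is_zero_at_infty.mono_left atTop_le_cocompact
    have := integral_Ioi_of_hasDerivAt_of_tendsto (a := 0)
      ((hκ.continuous.mul hVc).continuousWithinAt) (fun t _ => hd t)
      ((hint hκ1 hκ1' hVc).add (hint hκ.continuous hκ' (hU.sub hVc))) hzero
    rw [this]; simp [hV 0]
  refine sub_eq_zero.1 (Eq.trans ?_ hprod)
  rw [← integral_sub]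
  · refine integral_congr_ae (Filter.Eventually.of_forall fun t => ?_)
    simp only; ring
  · exact hint (hκ.continuous.sub hκ1) (hκ'.sub hκ1') (hU.sub hVc)
  · exact (hint hκ1 hκ1' hU).neg

/-- Pairing with `g` is a continuous linear functional and commutes with the `L²`-valued integral.
Writing `max τ 0` gives a scalar function continuous on the whole line. -/
lemma integral_memoryTerm_mul {n : ℕ}
    {u : ℝ → Lp ℝ 2 (volume : Measure (EuclideanSpace ℝ (Fin n)))} (hu : ContinuousOn u (Ici 0))
    {g : EuclideanSpace ℝ (Fin n) → ℝ} (hg : MemLp g 2) {t : ℝ} (ht : 0 ≤ t) :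
    ∫ x, memoryTerm u t x * g x =
      ∫ τ in (0 : ℝ)..t, Real.exp (-(t - τ)) * ∫ x, u (max τ 0) x * g x := by
  have hint : IntervalIntegrable (fun τ => Real.exp (-(t - τ)) • u τ) volume 0 t := by
    refine ContinuousOn.intervalIntegrable ?_
    rw [uIcc_of_le ht]
    have h1 : ContinuousOn (fun τ : ℝ => Real.exp (-(t - τ))) (Icc 0 t) := by fun_prop
    exact h1.smul (hu.mono Icc_subset_Ici_self)
  rw [integral_mul_eq_inner_toLp hg, memoryTerm]
  have := (innerSL ℝ (hg.toLp g)).intervalIntegral_comp_comm hint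
  simp only [innerSL_apply_apply] at this
  rw [← this]
  refine intervalIntegral.integral_congr fun τ hτ => ?_
  rw [uIcc_of_le ht] at hτ
  rw [max_eq_left hτ.1, integral_mul_eq_inner_toLp hg, inner_smul_right]

lemma continuous_integral_mul {n : ℕ}
    {u : ℝ → Lp ℝ 2 (volume : Measure (EuclideanSpace ℝ (Fin n)))} (hu : ContinuousOn u (Ici 0))
    {g : EuclideanSpace ℝ (Fin n) → ℝ} (hg : MemLp g 2) :
    Continuous fun t : ℝ => ∫ x, u (max t 0) x * g x := by
  have h1 : Continuous fun t : ℝ => u (max t 0) :=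
    hu.comp_continuous (by fun_prop) fun t => mem_Ici.2 (le_max_right _ _)
  simp_rw [integral_mul_eq_inner_toLp hg]
  exact continuous_const.inner h1

/-- The chosen representatives of `u t` need not be jointly measurable in time and space, so
measurability in time comes from lower semicontinuity on `L²`. -/
lemma measurable_lintegral_enorm_rpow {n : ℕ}
    {u : ℝ → Lp ℝ 2 (volume : Measure (EuclideanSpace ℝ (Fin n)))} (hu : ContinuousOn u (Ici 0))
    {w : EuclideanSpace ℝ (Fin n) → ENNReal} (hw : Measurable w) {p : ℝ} (hp : 0 ≤ p) :
    AEMeasurable (fun t => ∫⁻ x, ‖u t x‖ₑ ^ p * w x) (volume.restrict (Ioi 0)) := by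
  have h1 : Continuous fun t : ℝ => u (max t 0) :=
    hu.comp_continuous (by fun_prop) fun t => mem_Ici.2 (le_max_right _ _)
  refine ⟨fun t => ∫⁻ x, ‖u (max t 0) x‖ₑ ^ p * w x,
    ((lowerSemicontinuous_lintegral_enorm_rpow hw hp).comp h1).measurable, ?_⟩
  filter_upwards [ae_restrict_mem measurableSet_Ioi] with t ht
  rw [max_eq_left (le_of_lt ht)]

/-! ### The weak equation with time factor `κ - κ'` -/

/-- The weak form of the equation, tested with `(κ - κ') φ`. -/
lemma IsSobolevSolution.weak_equation_sub_deriv {n : ℕ} {σ p : ℝ}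
    {u₁ : EuclideanSpace ℝ (Fin n) → ℝ}
    {u : ℝ → Lp ℝ 2 (volume : Measure (EuclideanSpace ℝ (Fin n)))}
    (hu : IsSobolevSolution σ p u₁ ⊤ u) {κ : ℝ → ℝ} (hκ : ContDiff ℝ ∞ κ)
    (hκ' : HasCompactSupport κ) (hκ0 : κ 0 = 1) (hκ1 : deriv κ 0 = 0)
    {φ : EuclideanSpace ℝ (Fin n) → ℝ} (hφ : ContDiff ℝ ∞ φ) (hφ' : HasCompactSupport φ)
    (hA : MemLp (fracLaplacian σ φ) 2) :
    ∫ t in Ioi (0 : ℝ), ((iteratedDeriv 2 (κ - deriv κ) t * ∫ x, u t x * φ x)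
        + ((κ t - deriv κ t) * ∫ x, u t x * fracLaplacian σ φ x)
        - (deriv κ t * ∫ x, u t x * φ x)) =
      (∫ x, u₁ x * φ x) +
        ∫ t in Ioi (0 : ℝ), (κ t - deriv κ t) * ∫ x, |u t x| ^ p * φ x := by
  have hcont : ContinuousOn u (Ici 0) := by
    have := hu.continuousOn
    simpa [EReal.coe_lt_top, Ici_def] using this
  have hφ2 : MemLp φ 2 := hφ.continuous.memLp_of_hasCompactSupport hφ'
  have hκd : ContDiff ℝ ∞ (deriv κ) := (contDiff_infty_iff_deriv.1 hκ).2
  have hη : ContDiff ℝ ∞ (κ - deriv κ) := hκ.sub hκd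
  have hη' : HasCompactSupport (κ - deriv κ) := hκ'.sub hκ'.deriv
  have hη2 : Continuous (iteratedDeriv 2 (κ - deriv κ)) :=
    (contDiff_infty.1 hη 2).continuous_iteratedDeriv 2 le_rfl
  have hη2' : HasCompactSupport (iteratedDeriv 2 (κ - deriv κ)) := by
    rw [iteratedDeriv_succ, iteratedDeriv_one]; exact hη'.deriv.deriv
  set U : ℝ → ℝ := fun t => ∫ x, u (max t 0) x * φ x with hU
  set H : ℝ → ℝ := fun t => ∫ x, u (max t 0) x * fracLaplacian σ φ x with hH
  have hUc : Continuous U := continuous_integral_mul hcont hφ2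
  have hHc : Continuous H := continuous_integral_mul hcont hA
  set V : ℝ → ℝ := fun t => ∫ τ in (0 : ℝ)..t, Real.exp (-(t - τ)) * U τ with hV
  obtain ⟨hVc, hVeq⟩ := integral_sub_deriv_mul_memory hUc hκ hκ' (V := V) fun t => rfl
  have hint : ∀ {f g : ℝ → ℝ}, Continuous f → HasCompactSupport f → Continuous g →
      IntegrableOn (fun t => f t * g t) (Ioi 0) := fun hf hf' hg =>
    ((hf.mul hg).integrable_of_hasCompactSupport hf'.mul_right).integrableOn
  have hw := hu.weak_equation (κ - deriv κ) φ hη hη' (fun t _ => EReal.coe_lt_top t) hφ hφ'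
  have hη0 : (κ - deriv κ) 0 = 1 := by simp [hκ0, hκ1]
  rw [hη0, one_mul] at hw
  refine Eq.trans ?_ hw
  have hE : IntegrableOn (fun t => iteratedDeriv 2 (κ - deriv κ) t * U t + (κ - deriv κ) t * H t)
      (Ioi 0) := (hint hη2 hη2' hUc).add (hint hη.continuous hη' hHc)
  have hleft : ∫ t in Ioi (0 : ℝ), ((iteratedDeriv 2 (κ - deriv κ) t * ∫ x, u t x * φ x)
        + ((κ t - deriv κ t) * ∫ x, u t x * fracLaplacian σ φ x)
        - (deriv κ t * ∫ x, u t x * φ x)) =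
      ∫ t in Ioi (0 : ℝ), ((iteratedDeriv 2 (κ - deriv κ) t * U t + (κ - deriv κ) t * H t) +
        -(deriv κ t * U t)) := by
    refine setIntegral_congr_fun measurableSet_Ioi fun t ht => ?_
    simp only [hU, hH, max_eq_left (le_of_lt (mem_Ioi.1 ht)), Pi.sub_apply]
    ring
  have hright : ∫ t in Ioi (0 : ℝ),
      ((iteratedDeriv 2 (κ - deriv κ) t * ∫ x, u t x * φ x)
        + ((κ - deriv κ) t * ∫ x, u t x * fracLaplacian σ φ x)
        + ((κ - deriv κ) t * ∫ x, u t x * φ x)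
        - ((κ - deriv κ) t * ∫ x, memoryTerm u t x * φ x)) =
      ∫ t in Ioi (0 : ℝ), ((iteratedDeriv 2 (κ - deriv κ) t * U t + (κ - deriv κ) t * H t) +
        (κ t - deriv κ t) * (U t - V t)) := by
    refine setIntegral_congr_fun measurableSet_Ioi fun t ht => ?_
    have ht0 : 0 ≤ t := le_of_lt ht
    simp only [hU, hH, hV, max_eq_left ht0, Pi.sub_apply, integral_memoryTerm_mul hcont hφ2 ht0]
    ring
  have hN : IntegrableOn (fun t => -(deriv κ t * U t)) (Ioi 0) :=
    (hint hκd.continuous hκ'.deriv hUc).neg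
  have hM : IntegrableOn (fun t => (κ t - deriv κ t) * (U t - V t)) (Ioi 0) :=
    hint hη.continuous hη' (hUc.sub hVc)
  rw [hleft, hright, integral_add hE hN, integral_add hE hM, hVeq]

lemma ofReal_abs_rpow_mul {p : ℝ} (hp : 0 ≤ p) (a b : ℝ) :
    ENNReal.ofReal (|a| ^ p * b) = ‖a‖ₑ ^ p * ENNReal.ofReal b := by
  rw [ENNReal.ofReal_mul (by positivity), ← ENNReal.ofReal_rpow_of_nonneg (abs_nonneg _) hp,
    Real.enorm_eq_ofReal_abs]

lemma IsSobolevSolution.lintegral_Ioc_lt_top {n : ℕ} {σ p : ℝ}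
    {u₁ : EuclideanSpace ℝ (Fin n) → ℝ}
    {u : ℝ → Lp ℝ 2 (volume : Measure (EuclideanSpace ℝ (Fin n)))}
    (hu : IsSobolevSolution σ p u₁ ⊤ u)
    {φ : EuclideanSpace ℝ (Fin n) → ℝ} (hφ' : HasCompactSupport φ)
    (hφ1 : ∀ x, φ x ≤ 1) (t : ℝ) :
    ∫⁻ s in Ioc 0 t, ∫⁻ x, ‖u s x‖ₑ ^ p * ENNReal.ofReal (φ x) < ⊤ := by
  obtain ⟨r, hr⟩ := hφ'.isBounded.subset_ball 0
  refine lt_of_le_of_lt (lintegral_mono fun s => ?_)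
    (hu.power_locallyIntegrable t (EReal.coe_lt_top t) r)
  simp only
  rw [← lintegral_indicator measurableSet_ball]
  refine lintegral_mono fun x => ?_
  by_cases hx : x ∈ Metric.ball (0 : EuclideanSpace ℝ (Fin n)) r
  · rw [indicator_of_mem hx]
    exact mul_le_of_le_one_right' (by simpa using hφ1 x)
  · have : φ x = 0 := image_eq_zero_of_notMem_tsupport fun h => hx (hr h)
    simp [this]

/-- In the tested identity the datum and the nonlinear term together equal linear terms, whose
absolute value is at most `z`. The factor `2 * B` collects the terms with `η''` and with `κ'`.
Finally `κ ≤ κ - κ'` for positive times. -/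
lemma IsSobolevSolution.lintegral_cutoff_le {n : ℕ} {σ p : ℝ} (hp : 0 ≤ p)
    {u₁ : EuclideanSpace ℝ (Fin n) → ℝ}
    {u : ℝ → Lp ℝ 2 (volume : Measure (EuclideanSpace ℝ (Fin n)))}
    (hu : IsSobolevSolution σ p u₁ ⊤ u) {κ : ℝ → ℝ} (hκ : ContDiff ℝ ∞ κ)
    (hκ' : HasCompactSupport κ) (hκ0 : κ 0 = 1) (hκ1 : deriv κ 0 = 0)
    (hκn : ∀ t, 0 ≤ κ t) (hκd : ∀ t, 0 < t → deriv κ t ≤ 0) {a B C : ℝ}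
    (hB1 : ∀ t, |deriv κ t| ≤ B * κ t ^ a)
    (hB2 : ∀ t, |iteratedDeriv 2 (κ - deriv κ) t| ≤ B * κ t ^ a)
    (hC : ∀ t, |κ t - deriv κ t| ≤ C * κ t ^ a)
    {φ : EuclideanSpace ℝ (Fin n) → ℝ} (hφ : ContDiff ℝ ∞ φ) (hφ' : HasCompactSupport φ)
    (hφ0 : ∀ x, 0 ≤ φ x) (hφ1 : ∀ x, φ x ≤ 1)
    (hA : MemLp (fracLaplacian σ φ) 2) {z : ℝ} (hz0 : 0 ≤ z)
    (hz : ∫⁻ t in Ioi (0 : ℝ), ENNReal.ofReal (κ t ^ a) *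
      (ENNReal.ofReal (2 * B) * (∫⁻ x, ‖u t x‖ₑ * ENNReal.ofReal (φ x)) +
        ENNReal.ofReal C * ∫⁻ x, ‖u t x‖ₑ * ‖fracLaplacian σ φ x‖ₑ) ≤ ENNReal.ofReal z) :
    (∫ x, u₁ x * φ x) ≤ z ∧
    ∫⁻ t in Ioi (0 : ℝ), ENNReal.ofReal (κ t) * ∫⁻ x, ‖u t x‖ₑ ^ p * ENNReal.ofReal (φ x) ≤
      ENNReal.ofReal (z - ∫ x, u₁ x * φ x) := by
  have heq := hu.weak_equation_sub_deriv hκ hκ' hκ0 hκ1 hφ hφ' hA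
  set J := ∫ x, u₁ x * φ x with hJ
  have hcont : ContinuousOn u (Ici 0) := by
    have := hu.continuousOn
    simpa [EReal.coe_lt_top, Ici_def] using this
  have hκdc : Continuous (deriv κ) := (contDiff_infty_iff_deriv.1 hκ).2.continuous
  have hηc : Continuous fun t => κ t - deriv κ t := hκ.continuous.sub hκdc
  set X : ℝ → ENNReal := fun t => ∫⁻ x, ‖u t x‖ₑ ^ p * ENNReal.ofReal (φ x) with hX
  have hXm : AEMeasurable X (volume.restrict (Ioi 0)) :=
    measurable_lintegral_enorm_rpow hcont hφ.continuous.measurable.ennreal_ofReal hp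
  have hXr : ∀ t, ∫ x, |u t x| ^ p * φ x = (X t).toReal := fun t => by
    rw [integral_eq_lintegral_of_nonneg_ae (Filter.Eventually.of_forall fun x =>
      mul_nonneg (by positivity) (hφ0 x))]
    · simp only [hX, ofReal_abs_rpow_mul hp]
    · exact (((Lp.aestronglyMeasurable (u t)).aemeasurable.abs.pow_const p).mul
        hφ.continuous.measurable.aemeasurable).aestronglyMeasurable
  have hηκ : ∀ t, 0 < t → κ t ≤ κ t - deriv κ t := fun t ht => by linarith [hκd t ht]
  set Y : ENNReal := ∫⁻ t in Ioi (0 : ℝ), ENNReal.ofReal (κ t - deriv κ t) * X t with hY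
  obtain ⟨t₀, ht₀⟩ : ∃ t₀ : ℝ, ∀ t, t₀ < t → κ t - deriv κ t = 0 := by
    obtain ⟨r, hr⟩ := (hκ'.sub hκ'.deriv : HasCompactSupport (κ - deriv κ)).isBounded.subset_closedBall 0
    refine ⟨r, fun t ht => image_eq_zero_of_notMem_tsupport (f := κ - deriv κ) fun h => ?_⟩
    have := hr h
    rw [Metric.mem_closedBall, dist_zero_right, Real.norm_eq_abs] at this
    exact absurd ((le_abs_self t).trans this) (not_le.2 ht)
  obtain ⟨M, hM⟩ : ∃ M : ℝ, ∀ t, |κ t - deriv κ t| ≤ M := by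
    obtain ⟨M, hM⟩ := (hηc).bounded_above_of_compact_support
      (hκ'.sub hκ'.deriv : HasCompactSupport (κ - deriv κ))
    exact ⟨M, hM⟩
  have hXt := hu.lintegral_Ioc_lt_top hφ' hφ1 t₀
  -- Local integrability of `|u|^p` enters here. Without finiteness, `Y.toReal` would be the default
  -- value zero and the bound on it would be void.
  have hYtop : Y < ⊤ := by
    calc Y ≤ ∫⁻ t in Ioi (0 : ℝ), (Ioc 0 t₀).indicator (fun t => ENNReal.ofReal M * X t) t := by
          refine lintegral_mono_ae ?_
          filter_upwards [ae_restrict_mem measurableSet_Ioi] with t ht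
          by_cases h : t ≤ t₀
          · rw [indicator_of_mem (show t ∈ Ioc 0 t₀ from ⟨ht, h⟩)]
            gcongr
            exact (le_abs_self _).trans (hM t)
          · rw [ht₀ t (not_le.1 h)]; simp
      _ ≤ ∫⁻ t, (Ioc 0 t₀).indicator (fun t => ENNReal.ofReal M * X t) t := setLIntegral_le_lintegral _ _
      _ = ENNReal.ofReal M * ∫⁻ t in Ioc 0 t₀, X t := by
          rw [lintegral_indicator measurableSet_Ioc, lintegral_const_mul' _ _ ENNReal.ofReal_ne_top]
      _ < ⊤ := ENNReal.mul_lt_top ENNReal.ofReal_lt_top hXt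
  have hXae : ∀ᵐ t ∂(volume.restrict (Ioi (0 : ℝ))), t ≤ t₀ → X t < ⊤ := by
    have h1 : AEMeasurable X (volume.restrict (Ioc 0 t₀)) :=
      hXm.mono_measure (Measure.restrict_mono (fun t ht => ht.1) le_rfl)
    have h2 := ae_lt_top' h1 hXt.ne
    rw [ae_restrict_iff' measurableSet_Ioc] at h2
    rw [ae_restrict_iff' measurableSet_Ioi]
    filter_upwards [h2] with t ht h0 h1 using ht ⟨h0, h1⟩
  have hint : ∫ t in Ioi (0 : ℝ), (κ t - deriv κ t) * ∫ x, |u t x| ^ p * φ x = Y.toReal := by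
    simp_rw [hXr]
    rw [integral_eq_lintegral_of_nonneg_ae]
    · congr 1
      refine lintegral_congr_ae ?_
      filter_upwards [hXae, ae_restrict_mem measurableSet_Ioi] with t ht ht0
      by_cases h : t ≤ t₀
      · rw [ENNReal.ofReal_mul ((hκn t).trans (hηκ t ht0)), ENNReal.ofReal_toReal (ht h).ne]
      · rw [ht₀ t (not_le.1 h)]; simp
    · filter_upwards [ae_restrict_mem measurableSet_Ioi] with t ht0
      exact mul_nonneg ((hκn t).trans (hηκ t ht0)) ENNReal.toReal_nonneg
    · exact (hηc.aemeasurable.mul hXm.ennreal_toReal).aestronglyMeasurable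
  rw [hint] at heq
  have hle : J + Y.toReal ≤ z := by
    rw [← heq]
    refine (le_abs_self _).trans ?_
    rw [← ENNReal.ofReal_le_ofReal_iff hz0, ← Real.enorm_eq_ofReal_abs]
    refine (enorm_integral_le_lintegral_enorm _).trans (le_trans (lintegral_mono fun t => ?_) hz)
    have hU : ‖∫ x, u t x * φ x‖ₑ ≤ ∫⁻ x, ‖u t x‖ₑ * ENNReal.ofReal (φ x) := by
      refine (enorm_integral_le_lintegral_enorm _).trans (lintegral_mono fun x => ?_)
      rw [enorm_mul, Real.enorm_of_nonneg (hφ0 x)]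
    have hH : ‖∫ x, u t x * fracLaplacian σ φ x‖ₑ ≤ ∫⁻ x, ‖u t x‖ₑ * ‖fracLaplacian σ φ x‖ₑ := by
      refine (enorm_integral_le_lintegral_enorm _).trans (lintegral_mono fun x => ?_)
      rw [enorm_mul]
    have hκa : 0 ≤ κ t ^ a := Real.rpow_nonneg (hκn t) _
    have e1 : ‖deriv κ t‖ₑ ≤ ENNReal.ofReal B * ENNReal.ofReal (κ t ^ a) := by
      rw [Real.enorm_eq_ofReal_abs, ← ENNReal.ofReal_mul' hκa]
      exact ENNReal.ofReal_le_ofReal (hB1 t)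
    have e2 : ‖iteratedDeriv 2 (κ - deriv κ) t‖ₑ ≤ ENNReal.ofReal B * ENNReal.ofReal (κ t ^ a) := by
      rw [Real.enorm_eq_ofReal_abs, ← ENNReal.ofReal_mul' hκa]
      exact ENNReal.ofReal_le_ofReal (hB2 t)
    have e3 : ‖κ t - deriv κ t‖ₑ ≤ ENNReal.ofReal C * ENNReal.ofReal (κ t ^ a) := by
      rw [Real.enorm_eq_ofReal_abs, ← ENNReal.ofReal_mul' hκa]
      exact ENNReal.ofReal_le_ofReal (hC t)
    refine (enorm_sub_le).trans ?_
    refine (add_le_add_left (enorm_add_le _ _) _).trans ?_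
    simp only [enorm_mul]
    calc _ ≤ ENNReal.ofReal B * ENNReal.ofReal (κ t ^ a) * (∫⁻ x, ‖u t x‖ₑ * ENNReal.ofReal (φ x)) +
          ENNReal.ofReal C * ENNReal.ofReal (κ t ^ a) * (∫⁻ x, ‖u t x‖ₑ * ‖fracLaplacian σ φ x‖ₑ) +
          ENNReal.ofReal B * ENNReal.ofReal (κ t ^ a) * (∫⁻ x, ‖u t x‖ₑ * ENNReal.ofReal (φ x)) := by
          gcongr
      _ = _ := by
        rw [ENNReal.ofReal_mul zero_le_two, ENNReal.ofReal_ofNat]; ring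
  refine ⟨by linarith [ENNReal.toReal_nonneg (a := Y)], ?_⟩
  calc _ ≤ Y := by
        refine lintegral_mono_ae ?_
        filter_upwards [ae_restrict_mem measurableSet_Ioi] with t ht
        gcongr
        exact hηκ t ht
    _ = ENNReal.ofReal Y.toReal := (ENNReal.ofReal_toReal hYtop.ne).symm
    _ ≤ _ := ENNReal.ofReal_le_ofReal (by linarith)

/-! ### Hölder estimates in space and time -/

/-- Hölder's inequality with respect to a weight. -/
lemma lintegral_mul_weight_le {α : Type*} [MeasurableSpace α] {μ : Measure α} {p : ℝ} (hp : 1 < p)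
    {f w : α → ENNReal} (hf : AEMeasurable f μ) (hw : AEMeasurable w μ) :
    ∫⁻ x, f x * w x ∂μ ≤
      (∫⁻ x, f x ^ p * w x ∂μ) ^ (1 / p) * (∫⁻ x, w x ∂μ) ^ (1 - 1 / p) := by
  have hp0 : 0 < p := by linarith
  have hpq := Real.HolderConjugate.conjExponent hp
  set q := p.conjExponent
  have hq0 : 0 < q := hpq.symm.pos
  have hq : 1 - 1 / p = 1 / q := by
    rw [one_div, one_div]; linarith [hpq.inv_add_inv_eq_one]
  have h := ENNReal.lintegral_mul_le_Lp_mul_Lq μ hpq (f := fun x => f x * w x ^ (1 / p))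
    (g := fun x => w x ^ (1 / q)) (hf.mul (hw.pow_const _)) (hw.pow_const _)
  have e1 : ∀ x, (f x * w x ^ (1 / p)) * w x ^ (1 / q) = f x * w x := fun x => by
    rw [mul_assoc, ← ENNReal.rpow_add_of_nonneg _ _ (by positivity) (by positivity), ← hq]
    simp
  have e2 : ∀ x, (f x * w x ^ (1 / p)) ^ p = f x ^ p * w x := fun x => by
    rw [ENNReal.mul_rpow_of_nonneg _ _ hp0.le, ← ENNReal.rpow_mul, one_div_mul_cancel hp0.ne',
      ENNReal.rpow_one]
  have e3 : ∀ x, (w x ^ (1 / q)) ^ q = w x := fun x => by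
    rw [← ENNReal.rpow_mul, one_div_mul_cancel hq0.ne', ENNReal.rpow_one]
  simp only [Pi.mul_apply, e1, e2, e3] at h
  rwa [hq]

lemma memLp_two_fracLaplacian {n : ℕ} {σ : ℝ} (hσ : 0 < σ)
    {φ : EuclideanSpace ℝ (Fin n) → ℝ} (hφ : ContDiff ℝ ∞ φ) (hφ' : HasCompactSupport φ) :
    MemLp (fracLaplacian σ φ) 2 := by
  obtain ⟨C, hC, hCx⟩ := exists_abs_fracLaplacian_le hσ hφ hφ'
  have hm := (continuous_fracLaplacian hσ hφ hφ').aestronglyMeasurable (μ := volume)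
  rw [memLp_two_iff_integrable_sq hm]
  have hi : Integrable (fun x : EuclideanSpace ℝ (Fin n) => (1 + ‖x‖) ^ (-((n : ℝ) + 2 * σ))) := by
    refine integrable_one_add_norm ?_
    rw [finrank_euclideanSpace_fin]; linarith
  refine Integrable.mono' (hi.const_mul (C * C)) (hm.pow 2) (Filter.Eventually.of_forall fun x => ?_)
  have h0 : 0 ≤ (1 + ‖x‖) ^ (-((n : ℝ) + 2 * σ)) := by positivity
  have h1 : (1 + ‖x‖) ^ (-((n : ℝ) + 2 * σ)) ≤ 1 :=
    Real.rpow_le_one_of_one_le_of_nonpos (by linarith [norm_nonneg x]) (by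
      have : (0 : ℝ) ≤ n := Nat.cast_nonneg n
      linarith)
  rw [Real.norm_of_nonneg (sq_nonneg _), ← sq_abs, sq]
  calc _ ≤ (C * (1 + ‖x‖) ^ (-((n : ℝ) + 2 * σ))) * (C * 1) :=
        mul_le_mul (hCx x) ((hCx x).trans (by gcongr)) (abs_nonneg _) (by positivity)
    _ = _ := by ring

lemma lintegral_comp_inv_smul_sub {n : ℕ} {φ : EuclideanSpace ℝ (Fin n) → ℝ} (hφ : Continuous φ)
    (hφ' : HasCompactSupport φ) (hφ0 : ∀ x, 0 ≤ φ x) {R : ℝ} (hR : 0 < R)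
    (y : EuclideanSpace ℝ (Fin n)) :
    ∫⁻ x, ENNReal.ofReal (φ (R⁻¹ • x - y)) = ENNReal.ofReal (R ^ n * ∫ x, φ x) := by
  have hi : Integrable φ := hφ.integrable_of_hasCompactSupport hφ'
  have hi' : Integrable fun x => φ (R⁻¹ • x - y) :=
    (hi.comp_sub_right y).comp_smul (inv_ne_zero hR.ne')
  rw [← ofReal_integral_eq_lintegral_ofReal hi' (Filter.Eventually.of_forall fun x => hφ0 _),
    Measure.integral_comp_inv_smul volume (fun x => φ (x - y)) R, integral_sub_right_eq_self,
    finrank_euclideanSpace_fin, abs_of_pos (by positivity), smul_eq_mul]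

lemma lintegral_enorm_mul_le_enorm {α : Type*} [MeasurableSpace α] {μ : Measure α}
    (f : Lp ℝ 2 μ) {w : α → ENNReal} (hw : Measurable w) (hw1 : ∀ x, w x ≤ 1) :
    ∫⁻ x, ‖f x‖ₑ * w x ∂μ ≤ ‖f‖ₑ * (∫⁻ x, w x ∂μ) ^ (1 / 2 : ℝ) := by
  refine (lintegral_mul_weight_le one_lt_two (Lp.aestronglyMeasurable f).enorm
    hw.aemeasurable).trans ?_
  rw [show (1 : ℝ) - 1 / 2 = 1 / 2 by norm_num]
  gcongr
  rw [Lp.enorm_def, eLpNorm_eq_lintegral_rpow_enorm_toReal (by norm_num) (by norm_num)]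
  simp only [ENNReal.toReal_ofNat]
  gcongr with x
  exact mul_le_of_le_one_right' (hw1 x)

/-- The bound `S` depends on the weight only through its mass, hence is uniform over translates. It
rests on the boundedness of `u` in `L²` over compact time intervals. -/
lemma lintegral_cutoff_lt_top {n : ℕ}
    {u : ℝ → Lp ℝ 2 (volume : Measure (EuclideanSpace ℝ (Fin n)))} (hu : ContinuousOn u (Ici 0))
    {κ : ℝ → ℝ} (hκ0 : ∀ t, 0 ≤ κ t) (hκ1 : ∀ t, κ t ≤ 1) {L : ℝ}
    (hκL : ∀ t, L ≤ t → κ t = 0) {a : ℝ} (ha : 0 < a) (m : ENNReal) (hm : m ≠ ⊤) :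
    ∃ S : ENNReal, S < ⊤ ∧ ∀ w : EuclideanSpace ℝ (Fin n) → ENNReal, Measurable w →
      (∀ x, w x ≤ 1) → ∫⁻ x, w x = m →
      ∫⁻ t in Ioi (0 : ℝ), ENNReal.ofReal (κ t ^ a) * ∫⁻ x, ‖u t x‖ₑ * w x ≤ S := by
  obtain ⟨b, hb⟩ := isCompact_Icc.exists_bound_of_continuousOn
    (hu.mono (Icc_subset_Ici_self : Icc 0 L ⊆ Ici (0 : ℝ)))
  refine ⟨ENNReal.ofReal b * m ^ (1 / 2 : ℝ) * volume (Ioc 0 L), ?_, fun w hw hw1 hwm => ?_⟩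
  · refine ENNReal.mul_lt_top (ENNReal.mul_lt_top ENNReal.ofReal_lt_top ?_) (by simp)
    exact ENNReal.rpow_lt_top_of_nonneg (by norm_num) hm
  · calc _ ≤ ∫⁻ t in Ioi (0 : ℝ),
          (Ioc 0 L).indicator (fun _ => ENNReal.ofReal b * m ^ (1 / 2 : ℝ)) t := by
          refine lintegral_mono_ae ?_
          filter_upwards [ae_restrict_mem measurableSet_Ioi] with t ht
          by_cases h : t ≤ L
          · rw [indicator_of_mem (show t ∈ Ioc 0 L from ⟨ht, h⟩)]
            refine mul_le_of_le_one_of_le ?_ ?_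
            · simpa using Real.rpow_le_one (hκ0 t) (hκ1 t) ha.le
            · refine (lintegral_enorm_mul_le_enorm (u t) hw hw1).trans ?_
              rw [hwm]
              gcongr
              rw [← ofReal_norm]
              exact ENNReal.ofReal_le_ofReal (hb t ⟨le_of_lt ht, h⟩)
          · rw [hκL t (not_le.1 h).le, Real.zero_rpow ha.ne']; simp
      _ ≤ ∫⁻ t, (Ioc 0 L).indicator (fun _ => ENNReal.ofReal b * m ^ (1 / 2 : ℝ)) t :=
          setLIntegral_le_lintegral _ _
      _ = _ := by
          rw [lintegral_indicator measurableSet_Ioc, setLIntegral_const]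

/-- Hölder is used twice: in space with weight `w`, then in time with the indicator of `(0, L]`. The
exponent `1 / p` on `κ` is the one that restores `κ` after raising to the power `p`. -/
lemma lintegral_cutoff_rpow_le {n : ℕ}
    {u : ℝ → Lp ℝ 2 (volume : Measure (EuclideanSpace ℝ (Fin n)))} (hu : ContinuousOn u (Ici 0))
    {κ : ℝ → ℝ} (hκc : Continuous κ) (hκ0 : ∀ t, 0 ≤ κ t) {L : ℝ}
    (hκL : ∀ t, L ≤ t → κ t = 0) {p : ℝ} (hp : 1 < p)
    {w : EuclideanSpace ℝ (Fin n) → ENNReal} (hw : Measurable w) :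
    ∫⁻ t in Ioi (0 : ℝ), ENNReal.ofReal (κ t ^ (1 / p)) * ∫⁻ x, ‖u t x‖ₑ * w x ≤
      (∫⁻ t in Ioi (0 : ℝ), ENNReal.ofReal (κ t) * ∫⁻ x, ‖u t x‖ₑ ^ p * w x) ^ (1 / p) *
        (ENNReal.ofReal L * ∫⁻ x, w x) ^ (1 - 1 / p) := by
  have hp0 : 0 < p := by linarith
  have ha : 0 < 1 / p := by positivity
  have ha1 : 0 ≤ 1 - 1 / p := by
    rw [sub_nonneg, div_le_one hp0]; exact hp.le
  set X : ℝ → ENNReal := fun t => ∫⁻ x, ‖u t x‖ₑ ^ p * w x with hX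
  have hXm : AEMeasurable X (volume.restrict (Ioi 0)) :=
    measurable_lintegral_enorm_rpow hu hw hp0.le
  have hκm : AEMeasurable (fun t => ENNReal.ofReal (κ t)) (volume.restrict (Ioi 0)) :=
    hκc.measurable.ennreal_ofReal.aemeasurable
  set ind : ℝ → ENNReal := (Ioc 0 L).indicator fun _ => 1 with hind
  have hindm : Measurable ind := measurable_const.indicator measurableSet_Ioc
  calc _ ≤ ∫⁻ t in Ioi (0 : ℝ), ((ENNReal.ofReal (κ t) * X t) ^ (1 / p) * ind t) *
        (∫⁻ x, w x) ^ (1 - 1 / p) := by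
        refine lintegral_mono_ae ?_
        filter_upwards [ae_restrict_mem measurableSet_Ioi] with t ht
        by_cases h : t ≤ L
        · rw [hind, indicator_of_mem (show t ∈ Ioc 0 L from ⟨ht, h⟩), mul_one,
            ENNReal.mul_rpow_of_nonneg _ _ ha.le, ENNReal.ofReal_rpow_of_nonneg (hκ0 t) ha.le,
            mul_assoc]
          gcongr
          exact lintegral_mul_weight_le hp (Lp.aestronglyMeasurable (u t)).enorm hw.aemeasurable
        · rw [hκL t (not_le.1 h).le, Real.zero_rpow ha.ne']; simp
    _ = (∫⁻ t in Ioi (0 : ℝ), (ENNReal.ofReal (κ t) * X t) ^ (1 / p) * ind t) *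
        (∫⁻ x, w x) ^ (1 - 1 / p) := by
        rw [lintegral_mul_const'']
        exact ((hκm.mul hXm).pow_const _).mul hindm.aemeasurable
    _ ≤ ((∫⁻ t in Ioi (0 : ℝ), ((ENNReal.ofReal (κ t) * X t) ^ (1 / p)) ^ p * ind t) ^ (1 / p) *
          (∫⁻ t in Ioi (0 : ℝ), ind t) ^ (1 - 1 / p)) * (∫⁻ x, w x) ^ (1 - 1 / p) := by
        gcongr
        exact lintegral_mul_weight_le hp ((hκm.mul hXm).pow_const _) hindm.aemeasurable
    _ ≤ ((∫⁻ t in Ioi (0 : ℝ), ENNReal.ofReal (κ t) * X t) ^ (1 / p) *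
          (ENNReal.ofReal L) ^ (1 - 1 / p)) * (∫⁻ x, w x) ^ (1 - 1 / p) := by
        refine mul_le_mul' (mul_le_mul' (ENNReal.rpow_le_rpow (lintegral_mono fun t => ?_) ha.le)
          (ENNReal.rpow_le_rpow ?_ ha1)) le_rfl
        · simp only
          rw [← ENNReal.rpow_mul, one_div_mul_cancel hp0.ne', ENNReal.rpow_one]
          refine mul_le_of_le_one_right' ?_
          rw [hind]
          exact indicator_le' (fun _ _ => le_rfl) (fun _ _ => zero_le) t
        · refine (setLIntegral_le_lintegral _ _).trans ?_
          rw [hind, lintegral_indicator measurableSet_Ioc]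
          simp
    _ = _ := by
        rw [mul_assoc, ENNReal.mul_rpow_of_nonneg _ _ ha1]

/-! ### Domination by translates and the scaled estimate -/

/-- The fractional Laplacian of a bump is dominated by a summable superposition of translates of
the bump. -/
lemma exists_enorm_fracLaplacian_le_tsum {n : ℕ} {σ : ℝ} (hσ : 0 < σ)
    {φ : EuclideanSpace ℝ (Fin n) → ℝ} (hφ : ContDiff ℝ ∞ φ) (hφ' : HasCompactSupport φ)
    (hφ1 : ∀ x, ‖x‖ ≤ n → φ x = 1) :
    ∃ (ι : Type) (_ : Countable ι) (k : ι → EuclideanSpace ℝ (Fin n)) (w : ι → ENNReal),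
      ∑' i, w i ≠ ⊤ ∧
      ∀ x, ‖fracLaplacian σ φ x‖ₑ ≤ ∑' i, w i * ENNReal.ofReal (φ (x - k i)) := by
  obtain ⟨C, hC, hCx⟩ := exists_abs_fracLaplacian_le hσ hφ hφ'
  obtain ⟨ι, hι, k, w, hw0, hws, hw⟩ :=
    exists_lattice_weights n (q := n + 2 * σ) (by linarith)
  refine ⟨ι, hι, k, fun i => ENNReal.ofReal (C * w i), ?_, fun x => ?_⟩
  · rw [← ENNReal.ofReal_tsum_of_nonneg (fun i => mul_nonneg hC (hw0 i)) (hws.mul_left C)]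
    exact ENNReal.ofReal_ne_top
  · obtain ⟨i, hi, hwi⟩ := hw x
    refine le_trans ?_ (ENNReal.le_tsum i)
    rw [hφ1 _ hi, ENNReal.ofReal_one, mul_one, Real.enorm_eq_ofReal_abs]
    exact ENNReal.ofReal_le_ofReal ((hCx x).trans (by gcongr))

/-- The radius `n + 1` covers both the rounding error `n` of the lattice and the unit ball used for
lower bounds on the data. -/
lemma exists_bump (n : ℕ) : ∃ φ : EuclideanSpace ℝ (Fin n) → ℝ, ContDiff ℝ ∞ φ ∧
    HasCompactSupport φ ∧ (∀ x, 0 ≤ φ x) ∧ (∀ x, φ x ≤ 1) ∧ ∀ x, ‖x‖ ≤ n + 1 → φ x = 1 := by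
  let f : ContDiffBump (0 : EuclideanSpace ℝ (Fin n)) :=
    { rIn := n + 1, rOut := n + 2, rIn_pos := by positivity, rIn_lt_rOut := by linarith }
  exact ⟨f, f.contDiff, f.hasCompactSupport, fun x => f.nonneg, fun x => f.le_one,
    fun x hx => f.one_of_mem_closedBall (by simpa [f] using hx)⟩

lemma lintegral_tsum_translate_le {n : ℕ} {ι : Type} [Countable ι]
    {u : ℝ → Lp ℝ 2 (volume : Measure (EuclideanSpace ℝ (Fin n)))} (hu : ContinuousOn u (Ici 0))
    {κ : ℝ → ENNReal} (hκ : Measurable κ) (w : ι → ENNReal)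
    {f : ι → EuclideanSpace ℝ (Fin n) → ENNReal} (hf : ∀ i, Measurable (f i)) {S : ENNReal}
    (hS : ∀ i, ∫⁻ t in Ioi (0 : ℝ), κ t * ∫⁻ x, ‖u t x‖ₑ * f i x ≤ S) :
    ∫⁻ t in Ioi (0 : ℝ), κ t * ∫⁻ x, ‖u t x‖ₑ * ∑' i, w i * f i x ≤ (∑' i, w i) * S := by
  have hm : ∀ i, AEMeasurable (fun t => ∫⁻ x, ‖u t x‖ₑ * f i x) (volume.restrict (Ioi 0)) :=
    fun i => by simpa using measurable_lintegral_enorm_rpow hu (hf i) zero_le_one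
  have hm1 : ∀ i, AEMeasurable (fun t => κ t * ∫⁻ x, ‖u t x‖ₑ * f i x)
      (volume.restrict (Ioi 0)) := fun i => hκ.aemeasurable.mul (hm i)
  calc _ = ∫⁻ t in Ioi (0 : ℝ), ∑' i, w i * (κ t * ∫⁻ x, ‖u t x‖ₑ * f i x) := by
        refine lintegral_congr fun t => ?_
        have hum : AEMeasurable (fun x => ‖u t x‖ₑ) := (Lp.aestronglyMeasurable (u t)).enorm
        have hum1 : ∀ i, AEMeasurable fun x => ‖u t x‖ₑ * f i x :=
          fun i => hum.mul (hf i).aemeasurable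
        have hum2 : ∀ i, AEMeasurable fun x => ‖u t x‖ₑ * (w i * f i x) :=
          fun i => hum.mul ((hf i).const_mul _).aemeasurable
        simp_rw [← ENNReal.tsum_mul_left]
        rw [lintegral_tsum hum2, ← ENNReal.tsum_mul_left]
        congr 1
        funext i
        rw [mul_left_comm, ← lintegral_const_mul'' _ (hum1 i)]
        congr 1
        refine lintegral_congr fun x => ?_
        ring
    _ = ∑' i, w i * ∫⁻ t in Ioi (0 : ℝ), κ t * ∫⁻ x, ‖u t x‖ₑ * f i x := by
        rw [lintegral_tsum fun i => (hm1 i).const_mul _]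
        congr 1
        funext i
        rw [lintegral_const_mul'' _ (hm1 i)]
    _ ≤ ∑' i, w i * S := ENNReal.tsum_le_tsum fun i => by gcongr; exact hS i
    _ = _ := ENNReal.tsum_mul_right

/-- The test function estimate at scale `R` in space and `R ^ (2σ)` in time. -/
theorem exists_scaled_estimate (n : ℕ) {σ p : ℝ} (hσ : 0 < σ) (hp : 1 < p) :
    ∃ (φ : EuclideanSpace ℝ (Fin n) → ℝ) (D : ℝ), Continuous φ ∧ HasCompactSupport φ ∧
      (∀ x, 0 ≤ φ x) ∧ (∀ x, φ x ≤ 1) ∧ (∀ x, ‖x‖ ≤ 1 → φ x = 1) ∧ 0 ≤ D ∧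
      ∀ (u₁ : EuclideanSpace ℝ (Fin n) → ℝ)
        (u : ℝ → Lp ℝ 2 (volume : Measure (EuclideanSpace ℝ (Fin n)))),
        IsSobolevSolution σ p u₁ ⊤ u → ∀ R : ℝ, 1 ≤ R → ∀ B : ℝ,
        (∀ y, -B ≤ ∫ x, u₁ x * φ (R⁻¹ • x - y)) → ∃ M : ℝ, 0 ≤ M ∧
          M ≤ max 0 (D * R ^ (-(2 * σ) + (n + 2 * σ) * (1 - 1 / p)) * M ^ (1 / p) + B) ∧
          ∫ x, u₁ x * φ (R⁻¹ • x) ≤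
            D * R ^ (-(2 * σ) + (n + 2 * σ) * (1 - 1 / p)) * M ^ (1 / p) := by
  have hp0 : 0 < p := by linarith
  have ha0 : 0 < 1 / p := by positivity
  have ha1 : 1 / p < 1 := by rw [div_lt_one hp0]; exact hp
  have hb0 : 0 ≤ 1 - 1 / p := by linarith
  obtain ⟨φ, hφ, hφ', hφ0, hφ1, hφn⟩ := exists_bump n
  obtain ⟨ι, hι, k, w, hw, hwx⟩ := exists_enorm_fracLaplacian_le_tsum hσ hφ hφ'
    fun x hx => hφn x (hx.trans (by linarith))
  obtain ⟨C, hC, hcut⟩ := exists_time_cutoff ha1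
  set W := (∑' i, w i).toReal with hW
  set m := ∫ x, φ x with hm
  have hm0 : 0 ≤ m := integral_nonneg hφ0
  have hW0 : 0 ≤ W := ENNReal.toReal_nonneg
  -- Here `2 * C` stems from `η''` and `κ'`, and `C * W` from the fractional Laplacian with total
  -- weight `W`. The last factor comes from the space-time mass `2 * L * (R ^ n * m)` in Hölder's
  -- inequality.
  refine ⟨φ, (2 * C + C * W) * (2 * m) ^ (1 - 1 / p), hφ.continuous, hφ', hφ0, hφ1,
    fun x hx => hφn x (hx.trans (by have : (0 : ℝ) ≤ n := Nat.cast_nonneg n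
                                    linarith)), by positivity, ?_⟩
  intro u₁ u hu R hR B hB
  have hR0 : 0 < R := by linarith
  have hcont : ContinuousOn u (Ici 0) := by
    have := hu.continuousOn
    simpa [EReal.coe_lt_top, Ici_def] using this
  set L := R ^ (2 * σ) with hL
  have hL1 : 1 ≤ L := Real.one_le_rpow hR (by positivity)
  have hL0 : 0 < L := by linarith
  obtain ⟨κ, hκ, hκ', hκL, hκ0, hκ1, hκat, hκd0, hκd, hb1, hb2, hb3⟩ := hcut L hL1
  set ψ : EuclideanSpace ℝ (Fin n) → EuclideanSpace ℝ (Fin n) → ℝ :=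
    fun y x => φ (R⁻¹ • x - y) with hψ
  have hψs : ∀ y, ContDiff ℝ ∞ (ψ y) := fun y =>
    hφ.comp ((contDiff_id.const_smul R⁻¹).sub contDiff_const)
  have hψc : ∀ y, HasCompactSupport (ψ y) := fun y => by
    have h1 := hφ'.comp_homeomorph ((Homeomorph.smulOfNeZero R⁻¹ (inv_ne_zero hR0.ne')).trans
      (Homeomorph.addRight (-y)))
    convert! h1 using 1
  have hψm : ∀ y, Measurable fun x => ENNReal.ofReal (ψ y x) := fun y =>
    (hψs y).continuous.measurable.ennreal_ofReal
  have hψi : ∀ y, ∫⁻ x, ENNReal.ofReal (ψ y x) = ENNReal.ofReal (R ^ n * m) := fun y =>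
    lintegral_comp_inv_smul_sub hφ.continuous hφ' hφ0 hR0 y
  have hAψ : ∀ y x, ‖fracLaplacian σ (ψ y) x‖ₑ ≤
      ∑' i, (ENNReal.ofReal L⁻¹ * w i) * ENNReal.ofReal (ψ (y + k i) x) := fun y x => by
    rw [hψ, fracLaplacian_comp_inv_smul_sub σ φ hR0, enorm_mul, Real.rpow_neg hR0.le, ← hL,
      Real.enorm_of_nonneg (by positivity)]
    simp_rw [mul_assoc]
    rw [ENNReal.tsum_mul_left]
    refine mul_le_mul_right ?_ _
    simpa only [sub_sub] using hwx (R⁻¹ • x - y)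
  set S : EuclideanSpace ℝ (Fin n) → ENNReal := fun y => ∫⁻ t in Ioi (0 : ℝ),
    ENNReal.ofReal (κ t ^ (1 / p)) * ∫⁻ x, ‖u t x‖ₑ * ENNReal.ofReal (ψ y x) with hS
  set Y : EuclideanSpace ℝ (Fin n) → ENNReal := fun y => ∫⁻ t in Ioi (0 : ℝ),
    ENNReal.ofReal (κ t) * ∫⁻ x, ‖u t x‖ₑ ^ p * ENNReal.ofReal (ψ y x) with hY
  obtain ⟨S₀, hS₀, hS₀y⟩ := lintegral_cutoff_lt_top hcont hκ0 hκ1 hκL ha0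
    (ENNReal.ofReal (R ^ n * m)) ENNReal.ofReal_ne_top
  have hSb : ∀ y, S y ≤ S₀ := fun y => hS₀y _ (hψm y) (fun x => by simpa using hφ1 _) (hψi y)
  -- The supremum over translates absorbs the lattice sum; its finiteness is what makes the
  -- resulting inequality meaningful.
  set St := ⨆ y, S y with hSt
  have hSt_top : St < ⊤ := (iSup_le hSb).trans_lt hS₀
  have hκam : Measurable fun t => ENNReal.ofReal (κ t ^ (1 / p)) :=
    (hκ.continuous.measurable.pow_const _).ennreal_ofReal
  have hZ : ∀ y, ∫⁻ t in Ioi (0 : ℝ), ENNReal.ofReal (κ t ^ (1 / p)) *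
      (ENNReal.ofReal (2 * (C / L)) * (∫⁻ x, ‖u t x‖ₑ * ENNReal.ofReal (ψ y x)) +
        ENNReal.ofReal C * ∫⁻ x, ‖u t x‖ₑ * ‖fracLaplacian σ (ψ y) x‖ₑ) ≤
      ENNReal.ofReal (L⁻¹ * (2 * C + C * W)) * St := by
    intro y
    have hT := lintegral_tsum_translate_le hcont hκam (fun i => ENNReal.ofReal L⁻¹ * w i)
      (fun i => hψm (y + k i)) (S := St) fun i => le_iSup S (y + k i)
    have hNm : AEMeasurable (fun t => ∫⁻ x, ‖u t x‖ₑ * ENNReal.ofReal (ψ y x))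
        (volume.restrict (Ioi 0)) := by
      simpa using measurable_lintegral_enorm_rpow hcont (hψm y) zero_le_one
    have hNκ : AEMeasurable (fun t => ENNReal.ofReal (κ t ^ (1 / p)) *
        ∫⁻ x, ‖u t x‖ₑ * ENNReal.ofReal (ψ y x)) (volume.restrict (Ioi 0)) :=
      hκam.aemeasurable.mul hNm
    calc _ ≤ ∫⁻ t in Ioi (0 : ℝ), (ENNReal.ofReal (2 * (C / L)) * (ENNReal.ofReal (κ t ^ (1 / p)) *
            (∫⁻ x, ‖u t x‖ₑ * ENNReal.ofReal (ψ y x))) +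
          ENNReal.ofReal C * (ENNReal.ofReal (κ t ^ (1 / p)) * ∫⁻ x, ‖u t x‖ₑ *
            ∑' i, (ENNReal.ofReal L⁻¹ * w i) * ENNReal.ofReal (ψ (y + k i) x))) := by
          refine lintegral_mono fun t => ?_
          rw [mul_add, mul_left_comm]
          refine add_le_add_right ?_ _
          rw [mul_left_comm]
          gcongr with x
          exact hAψ y x
      _ = ENNReal.ofReal (2 * (C / L)) * S y + ENNReal.ofReal C *
          ∫⁻ t in Ioi (0 : ℝ), ENNReal.ofReal (κ t ^ (1 / p)) * ∫⁻ x, ‖u t x‖ₑ *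
            ∑' i, (ENNReal.ofReal L⁻¹ * w i) * ENNReal.ofReal (ψ (y + k i) x) := by
          rw [lintegral_add_left' (hNκ.const_mul _),
            lintegral_const_mul'' _ hNκ,
            lintegral_const_mul' _ _ ENNReal.ofReal_ne_top]
      _ ≤ ENNReal.ofReal (2 * (C / L)) * St + ENNReal.ofReal C *
          ((∑' i, ENNReal.ofReal L⁻¹ * w i) * St) := by
          gcongr
          exact le_iSup S y
      _ = _ := by
          rw [ENNReal.tsum_mul_left, ← ENNReal.ofReal_toReal hw, ← hW,
            ← ENNReal.ofReal_mul (by positivity), ← mul_assoc, ← ENNReal.ofReal_mul hC,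
            ← add_mul, ← ENNReal.ofReal_add (by positivity) (by positivity)]
          congr 2
          field_simp
  set z := L⁻¹ * (2 * C + C * W) * St.toReal with hz
  have hz0 : 0 ≤ z := by positivity
  have hzeq : ENNReal.ofReal (L⁻¹ * (2 * C + C * W)) * St = ENNReal.ofReal z := by
    rw [hz, ENNReal.ofReal_mul (p := L⁻¹ * (2 * C + C * W)) (by positivity),
      ENNReal.ofReal_toReal hSt_top.ne]
  have hkey : ∀ y, (∫ x, u₁ x * ψ y x) ≤ z ∧ Y y ≤ ENNReal.ofReal (z - ∫ x, u₁ x * ψ y x) :=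
    fun y => hu.lintegral_cutoff_le hp0.le hκ hκ' hκat hκd0 hκ0 hκd hb1 hb2 hb3 (hψs y) (hψc y)
      (fun x => hφ0 _) (fun x => hφ1 _) (memLp_two_fracLaplacian hσ (hψs y) (hψc y)) hz0
      ((hZ y).trans hzeq.le)
  set Mt := ⨆ y, Y y with hMt
  have hMt_le : Mt ≤ ENNReal.ofReal (z + B) := iSup_le fun y => (hkey y).2.trans
    (ENNReal.ofReal_le_ofReal (by linarith [hB y]))
  have hMt_top : Mt < ⊤ := hMt_le.trans_lt ENNReal.ofReal_lt_top
  -- The Hölder bound is uniform in `y`, so it passes to the suprema and the estimate closes on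
  -- `Mt`.
  have hStM : St ≤ Mt ^ (1 / p) * ENNReal.ofReal (2 * L * (R ^ n * m)) ^ (1 - 1 / p) := by
    refine iSup_le fun y => ?_
    refine (lintegral_cutoff_rpow_le hcont hκ.continuous hκ0 hκL hp (hψm y)).trans ?_
    rw [hψi, ← ENNReal.ofReal_mul (by positivity)]
    gcongr
    exact le_iSup Y y
  have hzM : z ≤ (2 * C + C * W) * (2 * m) ^ (1 - 1 / p) *
      R ^ (-(2 * σ) + (n + 2 * σ) * (1 - 1 / p)) * Mt.toReal ^ (1 / p) := by
    have h1 : St.toReal ≤ Mt.toReal ^ (1 / p) * (2 * L * (R ^ n * m)) ^ (1 - 1 / p) := by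
      have := ENNReal.toReal_mono (ENNReal.mul_ne_top
        (ENNReal.rpow_ne_top_of_nonneg ha0.le hMt_top.ne)
        (ENNReal.rpow_ne_top_of_nonneg hb0 ENNReal.ofReal_ne_top)) hStM
      rwa [ENNReal.toReal_mul, ← ENNReal.toReal_rpow, ← ENNReal.toReal_rpow,
        ENNReal.toReal_ofReal (by positivity)] at this
    have h2 : (2 * L * (R ^ n * m)) ^ (1 - 1 / p) =
        (2 * m) ^ (1 - 1 / p) * R ^ ((n + 2 * σ) * (1 - 1 / p)) := by
      rw [Real.rpow_mul hR0.le, ← Real.mul_rpow (by positivity) (by positivity),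
        Real.rpow_add hR0, Real.rpow_natCast]
      congr 1
      ring
    have h3 : L⁻¹ = R ^ (-(2 * σ)) := by rw [hL, Real.rpow_neg hR0.le]
    calc z ≤ L⁻¹ * (2 * C + C * W) *
          (Mt.toReal ^ (1 / p) * (2 * L * (R ^ n * m)) ^ (1 - 1 / p)) := by
          rw [hz]; gcongr
      _ = _ := by
        rw [h2, h3, Real.rpow_add hR0]; ring
  refine ⟨Mt.toReal, ENNReal.toReal_nonneg, ?_, ?_⟩
  · have h1 := ENNReal.toReal_mono ENNReal.ofReal_ne_top hMt_le
    rw [ENNReal.toReal_ofReal'] at h1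
    refine h1.trans (max_le ?_ (le_max_left _ _))
    exact le_trans (by linarith) (le_max_right _ _)
  · have h1 := (hkey 0).1
    simp only [hψ, sub_zero] at h1
    exact h1.trans hzM

/-! ### Elimination of `M`, growth comparison and averages of the data -/

lemma le_add_rpow_of_le_mul_rpow {p e B J M : ℝ} (hp : 1 < p) (he : 0 ≤ e) (hB : 0 ≤ B)
    (hM : 0 ≤ M) (h1 : M ≤ e * M ^ (1 / p) + B) (h2 : J ≤ e * M ^ (1 / p)) :
    J ≤ B + (2 * e) ^ (p / (p - 1)) := by
  have hp1 : 0 < p - 1 := by linarith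
  set Q := M ^ (1 / p) with hQ
  have hQ0 : 0 ≤ Q := Real.rpow_nonneg hM _
  have hQM : Q ^ p = M := by
    rw [hQ, ← Real.rpow_mul hM, one_div_mul_cancel (by linarith), Real.rpow_one]
  have hpow : 0 ≤ (2 * e) ^ (p / (p - 1)) := by positivity
  -- In the first case `2 * e * Q ≤ M ≤ e * Q + B` gives `e * Q ≤ B`. In the second, `Q ^ p < 2 * e
  -- * Q` bounds `Q` by a power of `e`.
  rcases le_or_gt (2 * (e * Q)) M with h | h
  · linarith
  · rcases hQ0.eq_or_lt with hQz | hQpos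
    · rw [← hQz] at h2; linarith
    have h3 : Q ^ (p - 1) ≤ 2 * e := by
      have : Q ^ (p - 1) * Q ≤ 2 * e * Q := by
        rw [← Real.rpow_add_one hQpos.ne', sub_add_cancel, hQM]; linarith
      exact le_of_mul_le_mul_right this hQpos
    have h4 : Q ≤ (2 * e) ^ (1 / (p - 1)) := by
      calc Q = (Q ^ (p - 1)) ^ (1 / (p - 1)) := by
            rw [← Real.rpow_mul hQ0, mul_one_div_cancel hp1.ne', Real.rpow_one]
        _ ≤ _ := Real.rpow_le_rpow (by positivity) h3 (by positivity)
    have he0 : 0 < 2 * e := lt_of_lt_of_le (Real.rpow_pos_of_pos hQpos _) h3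
    have h5 : (2 * e) ^ (p / (p - 1)) = 2 * e * (2 * e) ^ (1 / (p - 1)) := by
      rw [← Real.rpow_one_add' he0.le (by positivity)]
      congr 1; field_simp; ring
    have h6 : e * Q ≤ 2 * e * (2 * e) ^ (1 / (p - 1)) :=
      mul_le_mul (by linarith) h4 hQ0 he0.le
    linarith

lemma exists_gt_of_rpow_mul_log {γ β K F G : ℝ} (hβ : β < γ) (hγ : 0 < γ) (hK : 0 < K) (R₁ : ℝ) :
    ∃ R : ℝ, R₁ ≤ R ∧ 1 ≤ R ∧ F + G * R ^ β < K * R ^ γ / Real.log (1 + R) := by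
  -- Replacing `β` by `b ≥ 0` also absorbs the constant `F`. The gap `γ - b = 2 * d` is split in
  -- two: one half pays for the logarithm, the other for the constants.
  set b := max β 0 with hb
  have hbγ : b < γ := max_lt hβ hγ
  set d := (γ - b) / 2 with hd
  have hd0 : 0 < d := by rw [hd]; linarith
  have htend : Filter.Tendsto (fun R : ℝ => R ^ d) Filter.atTop Filter.atTop :=
    tendsto_rpow_atTop hd0
  obtain ⟨R, hR1, hR2, hR3⟩ := ((Filter.eventually_ge_atTop R₁).and
    ((Filter.eventually_ge_atTop (1 : ℝ)).and
      (htend.eventually_gt_atTop ((|F| + |G|) * (2 ^ d / d) / K)))).exists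
  refine ⟨R, hR1, hR2, ?_⟩
  have hR0 : 0 < R := by linarith
  have hlog : 0 < Real.log (1 + R) := Real.log_pos (by linarith)
  rw [lt_div_iff₀ hlog]
  have h1 : Real.log (1 + R) ≤ 2 ^ d / d * R ^ d := by
    calc Real.log (1 + R) ≤ (1 + R) ^ d / d := Real.log_le_rpow_div (by linarith) hd0
      _ ≤ (2 * R) ^ d / d := by gcongr; linarith
      _ = _ := by rw [Real.mul_rpow zero_le_two hR0.le]; ring
  have h2 : F + G * R ^ β ≤ (|F| + |G|) * R ^ b := by
    have e1 : R ^ β ≤ R ^ b := Real.rpow_le_rpow_of_exponent_le hR2 (le_max_left _ _)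
    have e2 : 1 ≤ R ^ b := Real.one_le_rpow hR2 (le_max_right _ _)
    calc F + G * R ^ β ≤ |F| * R ^ b + |G| * R ^ b := by
          refine add_le_add ((le_abs_self F).trans (le_mul_of_one_le_right (abs_nonneg F) e2)) ?_
          exact mul_le_mul (le_abs_self G) e1 (by positivity) (abs_nonneg G)
      _ = _ := by ring
  have h3 : (|F| + |G|) * (2 ^ d / d) < R ^ d * K := by
    rwa [div_lt_iff₀ hK] at hR3
  calc (F + G * R ^ β) * Real.log (1 + R)
      ≤ ((|F| + |G|) * R ^ b) * (2 ^ d / d * R ^ d) := by gcongr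
    _ = ((|F| + |G|) * (2 ^ d / d)) * (R ^ b * R ^ d) := by ring
    _ < (R ^ d * K) * (R ^ b * R ^ d) := by gcongr
    _ = K * (R ^ d * R ^ b * R ^ d) := by ring
    _ = K * R ^ γ := by
      rw [← Real.rpow_add hR0, ← Real.rpow_add hR0]
      congr 2; rw [hd]; ring

/-- Lower bounds for the averages of a function with a slowly decaying lower bound at infinity. -/
lemma exists_integral_mul_comp_inv_smul_ge {n : ℕ} (hn : 1 ≤ n) {s c R₀ : ℝ} (hs : 0 ≤ s)
    (hc : 0 < c)
    {u₁ : EuclideanSpace ℝ (Fin n) → ℝ} (hu₁ : LocallyIntegrable u₁)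
    (hlower : ∀ᵐ x : EuclideanSpace ℝ (Fin n),
      R₀ ≤ ‖x‖ → c * (‖x‖ ^ (-s) * (Real.log (1 + ‖x‖))⁻¹) ≤ u₁ x)
    {φ : EuclideanSpace ℝ (Fin n) → ℝ} (hφ : Continuous φ) (hφ' : HasCompactSupport φ)
    (hφ0 : ∀ x, 0 ≤ φ x) (hφ1 : ∀ x, φ x ≤ 1) (hφn : ∀ x, ‖x‖ ≤ 1 → φ x = 1) :
    ∃ B ≥ (0 : ℝ), ∃ K > (0 : ℝ), ∃ R₁ : ℝ,
      (∀ R : ℝ, 1 ≤ R → ∀ y, -B ≤ ∫ x, u₁ x * φ (R⁻¹ • x - y)) ∧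
      ∀ R : ℝ, 1 ≤ R → R₁ ≤ R →
        -B + K * R ^ ((n : ℝ) - s) / Real.log (1 + R) ≤ ∫ x, u₁ x * φ (R⁻¹ • x) := by
  set r := max R₀ 1 with hr
  have hr1 : 1 ≤ r := le_max_right _ _
  set U := Metric.ball (0 : EuclideanSpace ℝ (Fin n)) r with hU
  have hUi : IntegrableOn (fun x => |u₁ x|) U :=
    ((hu₁.integrableOn_isCompact (isCompact_closedBall 0 r)).mono_set
      Metric.ball_subset_closedBall).norm
  have hBi : Integrable (U.indicator fun x => -|u₁ x|) :=
    (IntegrableOn.integrable_indicator hUi.neg measurableSet_ball)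
  set B := ∫ x in U, |u₁ x| with hB
  have hB0 : 0 ≤ B := integral_nonneg fun x => abs_nonneg _
  have hBeq : ∫ x, U.indicator (fun x => -|u₁ x|) x = -B := by
    rw [integral_indicator measurableSet_ball, integral_neg]
  have hint : ∀ R : ℝ, 1 ≤ R → ∀ y, Integrable fun x => u₁ x * φ (R⁻¹ • x - y) := by
    intro R hR y
    have hR0 : R ≠ 0 := by linarith
    have h1 := hφ'.comp_homeomorph ((Homeomorph.smulOfNeZero R⁻¹ (inv_ne_zero hR0)).trans
      (Homeomorph.addRight (-y)))
    have h2 : HasCompactSupport fun x => φ (R⁻¹ • x - y) := by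
      convert! h1 using 1
    exact hu₁.integrable_smul_right_of_hasCompactSupport (by fun_prop) h2
  have hpt : ∀ᵐ x : EuclideanSpace ℝ (Fin n), r ≤ ‖x‖ →
      0 ≤ u₁ x ∧ c * (‖x‖ ^ (-s) * (Real.log (1 + ‖x‖))⁻¹) ≤ u₁ x := by
    filter_upwards [hlower] with x hx hrx
    have h1 := hx ((le_max_left _ _).trans hrx)
    have h2 : 0 ≤ Real.log (1 + ‖x‖) := Real.log_nonneg (by linarith [norm_nonneg x])
    exact ⟨le_trans (by positivity) h1, h1⟩
  obtain ⟨e, he⟩ : ∃ e : EuclideanSpace ℝ (Fin n), ‖e‖ = 1 :=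
    ⟨EuclideanSpace.single ⟨0, hn⟩ 1, by simp⟩
  set v := volume.real (Metric.ball (0 : EuclideanSpace ℝ (Fin n)) 1) with hv
  have hv0 : 0 < v := ENNReal.toReal_pos (Metric.measure_ball_pos _ _ one_pos).ne'
    measure_ball_lt_top.ne
  -- Outside the ball `U` the datum is nonnegative, so `B` bounds the negative part of every
  -- average. The requirement `R ≥ 2 * r` keeps the ball `A` below disjoint from `U`.
  refine ⟨B, hB0, c * ((1 / 4) ^ n * v), by positivity, 2 * r, fun R hR y => ?_, fun R hR hRr => ?_⟩
  · rw [← hBeq]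
    refine integral_mono_ae hBi (hint R hR y) ?_
    filter_upwards [hpt] with x hx
    by_cases h : x ∈ U
    · rw [indicator_of_mem h]
      have h1 : |u₁ x * φ (R⁻¹ • x - y)| ≤ |u₁ x| := by
        rw [abs_mul, abs_of_nonneg (hφ0 _)]
        exact mul_le_of_le_one_right (abs_nonneg _) (hφ1 _)
      exact (abs_le.1 (h1)).1
    · rw [indicator_of_notMem h]
      have : r ≤ ‖x‖ := by simpa [hU] using h
      exact mul_nonneg (hx this).1 (hφ0 _)
  · have hR0 : 0 < R := by linarith
    have hlog : 0 < Real.log (1 + R) := Real.log_pos (by linarith)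
    -- A ball of radius `R / 4` about a point of norm `3R / 4` lies in the annulus `R / 2 < ‖x‖ <
    -- R`, where the cutoff is one, and has volume proportional to `R ^ n`.
    set x₀ : EuclideanSpace ℝ (Fin n) := (3 / 4 * R) • e with hx₀
    have hx₀n : ‖x₀‖ = 3 / 4 * R := by
      rw [hx₀, norm_smul, he, mul_one, Real.norm_of_nonneg (by positivity)]
    set A := Metric.ball x₀ (R / 4) with hA
    have hAx : ∀ x ∈ A, R / 2 < ‖x‖ ∧ ‖x‖ < R := by
      intro x hx
      rw [hA, mem_ball_iff_norm] at hx
      have h1 := norm_sub_norm_le x x₀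
      have h2 := norm_sub_norm_le x₀ x
      rw [norm_sub_rev] at h2
      constructor <;> linarith
    have hAv : volume.real A = R ^ n * ((1 / 4) ^ n * v) := by
      rw [hA, Measure.real, Measure.addHaar_ball_of_pos volume x₀ (by positivity), ENNReal.toReal_mul,
        ENNReal.toReal_ofReal (by positivity), finrank_euclideanSpace_fin, hv, Measure.real,
        div_eq_mul_one_div, mul_pow, mul_assoc]
    set k := c * (R ^ (-s) * (Real.log (1 + R))⁻¹) with hk
    have hAi : Integrable (A.indicator fun _ => k) :=
      (integrable_indicator_iff measurableSet_ball).2 (integrableOn_const measure_ball_lt_top.ne)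
    have hAeq : ∫ x, A.indicator (fun _ => k) x =
        c * ((1 / 4) ^ n * v) * R ^ ((n : ℝ) - s) / Real.log (1 + R) := by
      rw [integral_indicator measurableSet_ball, setIntegral_const, hAv, smul_eq_mul, hk,
        sub_eq_add_neg, Real.rpow_add hR0, Real.rpow_natCast]
      ring
    rw [← hBeq, ← hAeq, ← integral_add hBi hAi]
    have hint0 := hint R hR 0
    simp only [sub_zero] at hint0
    refine integral_mono_ae (hBi.add hAi) hint0 ?_
    filter_upwards [hpt] with x hx
    by_cases h : x ∈ U
    · have hxA : x ∉ A := fun hxA => by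
        have h1 := (hAx x hxA).1
        have h2 : ‖x‖ < r := by simpa [hU] using h
        linarith
      rw [indicator_of_mem h, indicator_of_notMem hxA, add_zero]
      have h1 : |u₁ x * φ (R⁻¹ • x)| ≤ |u₁ x| := by
        rw [abs_mul, abs_of_nonneg (hφ0 _)]
        exact mul_le_of_le_one_right (abs_nonneg _) (hφ1 _)
      exact (abs_le.1 h1).1
    · have hrx : r ≤ ‖x‖ := by simpa [hU] using h
      obtain ⟨hx0, hx1⟩ := hx hrx
      rw [indicator_of_notMem h, zero_add]
      by_cases hxA : x ∈ A
      · rw [indicator_of_mem hxA]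
        have hxR := (hAx x hxA).2
        have hxpos : 0 < ‖x‖ := by linarith
        have h1 : φ (R⁻¹ • x) = 1 := hφn _ (by
          rw [norm_smul, norm_inv, Real.norm_of_nonneg hR0.le, inv_mul_le_iff₀ hR0]; linarith)
        rw [h1, mul_one]
        refine le_trans ?_ hx1
        have h2 : 0 < Real.log (1 + ‖x‖) := Real.log_pos (by linarith)
        rw [hk]
        gcongr c * (?_ * ?_)
        · exact Real.rpow_le_rpow_of_nonpos hxpos hxR.le (by linarith)
        · exact inv_anti₀ h2 (Real.log_le_log (by linarith) (by linarith))
      · rw [indicator_of_notMem hxA]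
        exact mul_nonneg hx0 (hφ0 _)

lemma tendsto_integral_mul_comp_inv_smul {n : ℕ} {u₁ φ : EuclideanSpace ℝ (Fin n) → ℝ}
    (hu₁ : Integrable u₁) (hφ : Continuous φ) (hφ0 : ∀ x, 0 ≤ φ x) (hφ1 : ∀ x, φ x ≤ 1)
    (hφz : φ 0 = 1) :
    Filter.Tendsto (fun R : ℝ => ∫ x, u₁ x * φ (R⁻¹ • x)) Filter.atTop (nhds (∫ x, u₁ x)) := by
  refine tendsto_integral_filter_of_dominated_convergence (fun x => ‖u₁ x‖)
    (Filter.Eventually.of_forall fun (R : ℝ) => ?_)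
    (Filter.Eventually.of_forall fun R => Filter.Eventually.of_forall fun x => ?_) hu₁.norm
    (Filter.Eventually.of_forall fun x => ?_)
  · have h1 : Continuous fun x : EuclideanSpace ℝ (Fin n) => φ (R⁻¹ • x) := by fun_prop
    exact hu₁.1.mul h1.aestronglyMeasurable
  · rw [norm_mul, Real.norm_of_nonneg (hφ0 _)]
    exact mul_le_of_le_one_right (norm_nonneg _) (hφ1 _)
  · have h1 : Filter.Tendsto (fun R : ℝ => R⁻¹ • x) Filter.atTop (nhds 0) := by
      simpa using (tendsto_inv_atTop_zero (𝕜 := ℝ)).smul_const x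
    have h2 := (hφ.tendsto 0).comp h1
    rw [hφz] at h2
    simpa using h2.const_mul (u₁ x)

/-! ### Contradiction for a global solution -/

theorem theorem4p1 (n : ℕ) (hn : 1 ≤ n) (σ m p : ℝ) (hσ : 1 ≤ σ) (hm1 : 1 ≤ m) (hm2 : m < 2)
    (u₁ : EuclideanSpace ℝ (Fin n) → ℝ) (hu₁ : MemLp u₁ (ENNReal.ofReal m) volume)
    (hpos : m = 1 → 0 < ∫ x, u₁ x)
    (hlower : 1 < m → ∃ c > (0 : ℝ), ∃ R₀ : ℝ, ∀ᵐ x : EuclideanSpace ℝ (Fin n),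
      R₀ ≤ ‖x‖ → c * (‖x‖ ^ (-((n : ℝ) / m)) * (Real.log (1 + ‖x‖))⁻¹) ≤ u₁ x)
    (hp1 : 1 < p) (hp2 : p < 1 + 2 * m * σ / n)
    (T : EReal) (u : ℝ → Lp ℝ 2 (volume : Measure (EuclideanSpace ℝ (Fin n))))
    (hu : IsSobolevSolution σ p u₁ T u) :
    T < ⊤ := by
  by_contra hT
  obtain rfl : T = ⊤ := not_lt_top_iff.1 hT
  have hσ0 : 0 < σ := by linarith
  have hn0 : (0 : ℝ) < n := by exact_mod_cast hn
  have hp0 : 0 < p := by linarith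
  have hpm : (p - 1) * n < 2 * m * σ := by
    rw [← lt_div_iff₀ hn0]; linarith
  obtain ⟨φ, D, hφ, hφ', hφ0, hφ1, hφn, hD, hest⟩ := exists_scaled_estimate n hσ0 hp1
  set α : ℝ := -(2 * σ) + (n + 2 * σ) * (1 - 1 / p) with hα
  have hαp : α * p = (p - 1) * n - 2 * σ := by
    rw [hα]; field_simp; ring
  rcases hm1.eq_or_lt with rfl | hm
  · have hi : Integrable u₁ := by
      rw [ENNReal.ofReal_one] at hu₁; exact memLp_one_iff_integrable.1 hu₁
    set B := ∫ x, |u₁ x| with hB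
    have hB0 : 0 ≤ B := integral_nonneg fun x => abs_nonneg _
    -- For `m = 1` subcriticality says `(p - 1) * n < 2 * σ`, that is, `α * p < 0`.
    have hα0 : α < 0 := by
      by_contra h
      have := mul_nonneg (not_lt.1 h) hp0.le
      linarith
    have hε : Filter.Tendsto (fun R : ℝ => D * R ^ α) Filter.atTop (nhds 0) := by
      have := (tendsto_rpow_neg_atTop (neg_pos.2 hα0)).const_mul D
      simpa using this
    have hbound : ∀ᶠ R : ℝ in Filter.atTop,
        ∫ x, u₁ x * φ (R⁻¹ • x) ≤ D * R ^ α * (2 * B + 2) := by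
      filter_upwards [Filter.eventually_ge_atTop (1 : ℝ),
        hε.eventually_le_const (show (0 : ℝ) < 1 / 2 by norm_num)] with R hR hRε
      obtain ⟨M, hM0, hM1, hM2⟩ := hest u₁ u hu R hR B fun y => by
        have h1 : |∫ x, u₁ x * φ (R⁻¹ • x - y)| ≤ B := by
          rw [hB]
          refine norm_integral_le_of_norm_le (f := fun x => u₁ x * φ (R⁻¹ • x - y)) hi.abs
            (Filter.Eventually.of_forall fun x => ?_)
          rw [norm_mul, Real.norm_of_nonneg (hφ0 _)]
          exact mul_le_of_le_one_right (norm_nonneg _) (hφ1 _)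
        exact (abs_le.1 h1).1
      have hε0 : 0 ≤ D * R ^ α := by positivity
      -- Once `D * R ^ α ≤ 1 / 2`, this crude bound gives `M ≤ (1 + M) / 2 + B`, hence `1 + M ≤ 2 *
      -- B + 2` independently of `R`.
      have hQ : M ^ (1 / p) ≤ 1 + M := by
        calc M ^ (1 / p) ≤ (1 + M) ^ (1 / p) := by gcongr; linarith
          _ ≤ (1 + M) ^ (1 : ℝ) := Real.rpow_le_rpow_of_exponent_le (by linarith)
            (by rw [div_le_one hp0]; exact hp1.le)
          _ = _ := Real.rpow_one _
      have hQ0 : 0 ≤ M ^ (1 / p) := Real.rpow_nonneg hM0 _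
      rw [max_eq_right (by positivity)] at hM1
      have h2 : D * R ^ α * M ^ (1 / p) ≤ 1 / 2 * (1 + M) := mul_le_mul hRε hQ hQ0 (by norm_num)
      refine hM2.trans ?_
      gcongr
      linarith
    have hlim := le_of_tendsto_of_tendsto
      (tendsto_integral_mul_comp_inv_smul hi hφ hφ0 hφ1 (hφn 0 (by simp)))
      (hε.mul_const (2 * B + 2)) hbound
    rw [zero_mul] at hlim
    exact absurd (hpos rfl) (not_lt.2 hlim)
  · obtain ⟨c, hc, R₀, hcR⟩ := hlower hm
    have hm0 : 0 < m := by linarith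
    have hloc : LocallyIntegrable u₁ :=
      hu₁.locallyIntegrable (by simpa using hm1)
    obtain ⟨B, hB0, K, hK, R₁, hBy, hKR⟩ := exists_integral_mul_comp_inv_smul_ge hn
      (s := (n : ℝ) / m) (by positivity) hc hloc hcR hφ hφ' hφ0 hφ1 hφn
    have hp1' : 0 < p - 1 := by linarith
    have hγ : 0 < (n : ℝ) - n / m := by
      rw [sub_pos, div_lt_iff₀ hm0]; nlinarith
    -- This is the subcriticality condition, rewritten as `n / m < 2 * σ / (p - 1)`.
    have hβ : α * (p / (p - 1)) < (n : ℝ) - n / m := by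
      have e1 : α * (p / (p - 1)) = n - 2 * σ / (p - 1) := by
        rw [← mul_div_assoc, hαp]; field_simp
      rw [e1]
      have : (n : ℝ) / m < 2 * σ / (p - 1) := by
        rw [div_lt_div_iff₀ hm0 hp1']; linarith
      linarith
    obtain ⟨R, hR1, hR, hRlt⟩ := exists_gt_of_rpow_mul_log (F := 2 * B)
      (G := (2 * D) ^ (p / (p - 1))) hβ hγ hK R₁
    have hR0 : 0 < R := by linarith
    obtain ⟨M, hM0, hM1, hM2⟩ := hest u₁ u hu R hR B (hBy R hR)
    have hQ0 : 0 ≤ M ^ (1 / p) := Real.rpow_nonneg hM0 _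
    rw [max_eq_right (by positivity)] at hM1
    have h1 := le_add_rpow_of_le_mul_rpow hp1 (by positivity) hB0 hM0 hM1 hM2
    have h2 : (2 * (D * R ^ α)) ^ (p / (p - 1)) =
        (2 * D) ^ (p / (p - 1)) * R ^ (α * (p / (p - 1))) := by
      rw [← mul_assoc, Real.mul_rpow (by positivity) (by positivity), ← Real.rpow_mul hR0.le]
    rw [h2] at h1
    have h3 := hKR R hR hR1
    linarith
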